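/- Let $k$ be a field of characteristic $0$, let $L$ be a finite set with $|L|=8$, let $U$ be a two-dimensional $k$-vector space and let $\omega$ be a non-degenerate alternating form on $U$. Put $V=\big((U^*)^{\otimes L}\big)^{\mathrm{SL}(U)}$, on which the symmetric group $S_L$ acts by permuting the tensor factors. For a directed matching $\Gamma$ on $L$ (a partition of $L$ into four ordered pairs, the edges of $\Gamma$) let $X_\Gamma=\prod_{e}\omega_e\in V$, the product being taken over the edges $e=(i,j)$ of $\Gamma$, where $\omega_e\in(U^*)^{\otimes\{i,j\}}$ is the copy of $\omega$. Let $s$ be a non-zero skew-invariant element of $\mathrm{Sym}^3(V)$, that is, $\sigma s=\mathrm{sgn}(\sigma)\,s$ for all $\sigma\in S_L$; or let $s$ be the skew-average $\frac1{8!}\sum_{\sigma\in S_L}\mathrm{sgn}(\sigma)\,\sigma(X_\Gamma^3)$ of the cube of any matching $\Gamma$. Then: 1. The partial derivatives of $s$ have no linear syzygies: if $x_1,\dots,x_n$ is a basis of $V$, $\partial_i$ is the partial derivative with respect to $x_i$ on $\mathrm{Sym}(V)=k[x_1,\dots,x_n]$, and $a_1,\dots,a_n\in\mathrm{Sym}^1(V)$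 satisfy $\sum_{i=1}^n a_i\,\partial_i s=0$, then $a_i=0$ for all $i$. 2. Equivalently, the annihilator $\mathfrak g=\{A\in\mathfrak{gl}(V): A\cdot s=0\}$ of $s$ is zero, where $A\in\mathfrak{gl}(V)=\mathrm{End}(V)$ acts on $\mathrm{Sym}(V)$ as the derivation extending $A$ on $V$. -/

import Mathlib

open scoped TensorProduct

noncomputable section

namespace EightPoints

/-! ### Derivations of a symmetric algebra -/

section SymmetricAlgebra

variable {k M : Type*} [Field k] [AddCommGroup M] [Module k M]

/-- The algebra map `a ↦ a + ε D(a)` into the dual numbers over `Sym(M)`, for `D` the derivation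
with prescribed values `f` on `M`. -/
def dualNumberLift (f : M →ₗ[k] SymmetricAlgebra k M) :
    SymmetricAlgebra k M →ₐ[k] TrivSqZeroExt (SymmetricAlgebra k M) (SymmetricAlgebra k M) :=
  SymmetricAlgebra.lift
    ((TrivSqZeroExt.inlAlgHom k (SymmetricAlgebra k M) (SymmetricAlgebra k M)).toLinearMap ∘ₗ
        SymmetricAlgebra.ι k M
      + (TrivSqZeroExt.inrHom (SymmetricAlgebra k M) (SymmetricAlgebra k M)).restrictScalars k ∘ₗ f)

theorem dualNumberLift_fst (f : M →ₗ[k] SymmetricAlgebra k M) (a : SymmetricAlgebra k M) :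
    (dualNumberLift f a).fst = a := by
  have h : (TrivSqZeroExt.fstHom k (SymmetricAlgebra k M) (SymmetricAlgebra k M)).comp
      (dualNumberLift f) = AlgHom.id k _ := by
    apply SymmetricAlgebra.algHom_ext
    ext v
    simp [dualNumberLift]
  exact congrArg (fun F : SymmetricAlgebra k M →ₐ[k] SymmetricAlgebra k M => F a) h

/-- The unique `k`-derivation of `Sym(M)` which restricts to `f` on `M`. -/
def symDerivation (f : M →ₗ[k] SymmetricAlgebra k M) :
    Derivation k (SymmetricAlgebra k M) (SymmetricAlgebra k M) :=
  Derivation.mk'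
    ((TrivSqZeroExt.sndHom (SymmetricAlgebra k M) (SymmetricAlgebra k M)).restrictScalars k ∘ₗ
      (dualNumberLift f).toLinearMap)
    (fun a b => by simp [dualNumberLift_fst, mul_comm])

@[simp]
theorem symDerivation_ι (f : M →ₗ[k] SymmetricAlgebra k M) (v : M) :
    symDerivation f (SymmetricAlgebra.ι k M v) = f v := by
  simp [symDerivation, dualNumberLift]

theorem derivation_ext {D₁ D₂ : Derivation k (SymmetricAlgebra k M) (SymmetricAlgebra k M)}
    (h : ∀ v, D₁ (SymmetricAlgebra.ι k M v) = D₂ (SymmetricAlgebra.ι k M v)) : D₁ = D₂ := by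
  ext a
  induction a using SymmetricAlgebra.induction with
  | algebraMap r => simp
  | ι x => exact h x
  | mul a b ha hb => simp [ha, hb]
  | add a b ha hb => simp [ha, hb]

/-- `Sym^n(M)`, the `n`-th graded piece of the symmetric algebra. -/
def symPow (k M : Type*) [Field k] [AddCommGroup M] [Module k M] (n : ℕ) :
    Submodule k (SymmetricAlgebra k M) :=
  LinearMap.range (SymmetricAlgebra.ι k M) ^ n

/-- The partial derivative `∂_φ` of `Sym(M)` along `φ ∈ M^*`: the derivation which sends `v ∈ M`
to `⟨φ, v⟩`. -/
def partialDeriv (φ : Module.Dual k M) :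
    Derivation k (SymmetricAlgebra k M) (SymmetricAlgebra k M) :=
  symDerivation (Algebra.linearMap k (SymmetricAlgebra k M) ∘ₗ φ)

/-- The natural action of `A ∈ gl(M)` on `Sym(M)`:
`A (v₁ ⋯ vₙ) = ∑ᵢ v₁ ⋯ (A vᵢ) ⋯ vₙ`. -/
def glAction (A : Module.End k M) :
    Derivation k (SymmetricAlgebra k M) (SymmetricAlgebra k M) :=
  symDerivation (SymmetricAlgebra.ι k M ∘ₗ A)

theorem glAction_add (A B : Module.End k M) : glAction (A + B) = glAction A + glAction B :=
  derivation_ext fun v => by simp [glAction]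

theorem glAction_smul (c : k) (A : Module.End k M) : glAction (c • A) = c • glAction A :=
  derivation_ext fun v => by simp [glAction]

section Lie

attribute [local instance 100] LieRing.ofAssociativeRing

theorem glAction_lie (A B : Module.End k M) : glAction ⁅A, B⁆ = ⁅glAction A, glAction B⁆ :=
  derivation_ext fun v => by simp [glAction, Derivation.commutator_apply, Ring.lie_def]

/-- The annihilator of `s ∈ Sym(M)` in the Lie algebra `gl(M)`. -/
def annihilator (s : SymmetricAlgebra k M) : LieSubalgebra k (Module.End k M) where
  carrier := {A | glAction A s = 0}
  zero_mem' := by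
    have h := glAction_smul (0 : k) (0 : Module.End k M)
    simp only [zero_smul] at h
    simp [h]
  add_mem' {A B} hA hB := by
    simp only [Set.mem_ofPred_eq] at hA hB ⊢
    simp [glAction_add, hA, hB]
  smul_mem' c A hA := by
    simp only [Set.mem_ofPred_eq] at hA ⊢
    simp [glAction_smul, hA]
  lie_mem' {A B} hA hB := by
    change glAction A s = 0 at hA
    change glAction B s = 0 at hB
    change glAction ⁅A, B⁆ s = 0
    simp [glAction_lie, Derivation.commutator_apply, hA, hB]

end Lie

/-- With `x₁, …, xₙ` the basis `x` of `M` and `∂ᵢ` the partial derivative with respect to `xᵢ`: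
the only linear forms `a₁, …, aₙ ∈ Sym^1(M)` with `∑ aᵢ ∂ᵢ s = 0` are `a₁ = ⋯ = aₙ = 0`. -/
def NoLinearSyzygies {n : ℕ} (x : Module.Basis (Fin n) k M) (s : SymmetricAlgebra k M) : Prop :=
  ∀ a : Fin n → SymmetricAlgebra k M, (∀ i, a i ∈ symPow k M 1) →
    ∑ i, a i * partialDeriv (x.coord i) s = 0 → ∀ i, a i = 0

end SymmetricAlgebra

/-! ### The space `V = ((U^*)^{⊗ L})^{SL(U)}` -/

section Space

variable (k L U : Type*) [Field k] [AddCommGroup U] [Module k U]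

/-- `(U^*)^{⊗ L}`. -/
abbrev DualTensor : Type _ := ⨂[k] _ : L, Module.Dual k U

/-- `V = ((U^*)^{⊗ L})^{SL(U)}`; here `g ∈ SL(U)` acts on each factor `U^*` by `φ ↦ φ ∘ g⁻¹`. -/
def V : Submodule k (DualTensor k L U) where
  carrier := {t | ∀ g : SpecialLinearGroup k U,
    PiTensorProduct.map (fun _ : L => LinearMap.dualMap ((g⁻¹).1 : U →ₗ[k] U)) t = t}
  zero_mem' := fun g => map_zero _
  add_mem' := fun hs ht g => by rw [map_add, hs g, ht g]
  smul_mem' := fun c t ht g => by rw [map_smul, ht g]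

instance : AddCommGroup (V k L U) := Module.addCommMonoidToAddCommGroup k

variable {L}

/-- The action of `σ ∈ S_L` on `V` by permuting the tensor factors: the factor in place `l` is
moved to the place `σ l`. -/
def permV (σ : Equiv.Perm L) : V k L U →ₗ[k] V k L U :=
  LinearMap.restrict
    (PiTensorProduct.reindex k (fun _ : L => Module.Dual k U) σ).toLinearMap
    (fun t ht g => by
      have h := PiTensorProduct.map_reindex
        (fun _ : L => LinearMap.dualMap ((g⁻¹).1 : U →ₗ[k] U)) σ t
      rw [ht g] at h
      exact h)

/-- The induced action of `σ ∈ S_L` on `Sym(V)` by algebra endomorphisms. -/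
def permSym (σ : Equiv.Perm L) : SymmetricAlgebra k (V k L U) →ₐ[k] SymmetricAlgebra k (V k L U) :=
  SymmetricAlgebra.lift (SymmetricAlgebra.ι k (V k L U) ∘ₗ permV k U σ)

variable {k U}

/-- `σ s = sgn(σ) s` for all `σ ∈ S_L`. -/
def IsSkewInvariant [Fintype L] [DecidableEq L] (s : SymmetricAlgebra k (V k L U)) : Prop :=
  ∀ σ : Equiv.Perm L, permSym k U σ s = (Equiv.Perm.sign σ : ℤ) • s

/-- The skew-average `(1 / |S_L|) ∑_σ sgn(σ) σ f`. -/
def skewAverage [Fintype L] [DecidableEq L] (f : SymmetricAlgebra k (V k L U)) :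
    SymmetricAlgebra k (V k L U) :=
  (Fintype.card (Equiv.Perm L) : k)⁻¹ •
    ∑ σ : Equiv.Perm L, (Equiv.Perm.sign σ : ℤ) • permSym k U σ f

end Space

/-! ### The elements of `V` attached to directed matchings

A directed matching on `L` (with its `m` edges numbered) is a bijection
`Γ : Fin m × Fin 2 ≃ L`; its `i`-th edge runs from `Γ (i, 0)` to `Γ (i, 1)`. -/

section Matching

variable {k L U : Type*} [Field k] [AddCommGroup U] [Module k U]

theorem prod_update {m : ℕ} (ω : LinearMap.BilinForm k U) (Γ : Fin m × Fin 2 ≃ L)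
    [DecidableEq L] (u : L → U) (j : Fin m) (c : Fin 2) (v : U) :
    ∏ i, ω (Function.update u (Γ (j, c)) v (Γ (i, 0))) (Function.update u (Γ (j, c)) v (Γ (i, 1)))
      = (if c = 0 then ω v (u (Γ (j, 1))) else ω (u (Γ (j, 0))) v) *
        ∏ i ∈ Finset.univ.erase j, ω (u (Γ (i, 0))) (u (Γ (i, 1))) := by
  rw [← Finset.mul_prod_erase Finset.univ _ (Finset.mem_univ j)]
  congr 1
  · fin_cases c <;> simp
  · refine Finset.prod_congr rfl fun i hi => ?_
    have hij : i ≠ j := Finset.ne_of_mem_erase hi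
    simp [hij]

/-- The multilinear form `(u_l)_{l ∈ L} ↦ ∏ ω(u_a, u_b)` on `U^L`, the product taken over the
edges `(a, b)` of `Γ`. -/
def matchingForm (ω : LinearMap.BilinForm k U) {m : ℕ} (Γ : Fin m × Fin 2 ≃ L) :
    MultilinearMap k (fun _ : L => U) k where
  toFun u := ∏ i, ω (u (Γ (i, 0))) (u (Γ (i, 1)))
  map_update_add' {_} u l v w := by
    obtain ⟨⟨j, c⟩, rfl⟩ := Γ.surjective l
    simp only [prod_update]
    split_ifs <;> simp [add_mul]
  map_update_smul' {_} u l c v := by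
    obtain ⟨⟨j, d⟩, rfl⟩ := Γ.surjective l
    simp only [prod_update]
    split_ifs <;> simp [mul_assoc]

/-- `X_Γ = ∏ ω_e ∈ (U^*)^{⊗ L}`, the product taken over the edges `e` of `Γ`. Under the natural
isomorphism of `(U^*)^{⊗ L}` with the dual of `U^{⊗ L}` it is the form `matchingForm ω Γ`. -/
def matchingTensor [Finite L] [FiniteDimensional k U] (ω : LinearMap.BilinForm k U) {m : ℕ} (Γ : Fin m × Fin 2 ≃ L) :
    DualTensor k L U :=
  PiTensorProduct.dualDistribEquiv.symm (PiTensorProduct.lift (matchingForm ω Γ))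

theorem dualDistrib_matchingTensor [Finite L] [FiniteDimensional k U] (ω : LinearMap.BilinForm k U) {m : ℕ}
    (Γ : Fin m × Fin 2 ≃ L) (u : L → U) :
    PiTensorProduct.dualDistrib (matchingTensor ω Γ) (PiTensorProduct.tprod k u) =
      ∏ i, ω (u (Γ (i, 0))) (u (Γ (i, 1))) := by
  have h : PiTensorProduct.dualDistrib (matchingTensor ω Γ) =
      PiTensorProduct.lift (matchingForm ω Γ) :=
    PiTensorProduct.dualDistribEquiv.apply_symm_apply (PiTensorProduct.lift (matchingForm ω Γ))
  rw [h, PiTensorProduct.lift.tprod]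
  rfl

theorem dualDistrib_map [Finite L] (t : DualTensor k L U) (f : U →ₗ[k] U) :
    PiTensorProduct.dualDistrib (PiTensorProduct.map (fun _ : L => LinearMap.dualMap f) t) =
      PiTensorProduct.dualDistrib t ∘ₗ PiTensorProduct.map (fun _ : L => f) := by
  have := Fintype.ofFinite L
  induction t using PiTensorProduct.induction_on with
  | smul_tprod r φ =>
    ext u
    simp [PiTensorProduct.map_tprod]
  | add a b ha hb => simp [ha, hb, LinearMap.add_comp]

/-- An alternating form on a plane is invariant under `SL(U)`. -/
theorem form_invariant [FiniteDimensional k U] (hU : Module.finrank k U = 2) {ω : LinearMap.BilinForm k U}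
    (hω : ω.IsAlt) (g : SpecialLinearGroup k U) (u v : U) : ω (g.1 u) (g.1 v) = ω u v := by
  let b : Module.Basis (Fin 2) k U := Module.finBasisOfFinrankEq k U hU
  have hdet : (LinearMap.toMatrix b b (g.1 : U →ₗ[k] U)).det = 1 := by
    rw [LinearMap.det_toMatrix]
    exact g.det_eq_one
  have hg : ∀ j, g.1 (b j) = ∑ i, LinearMap.toMatrix b b (g.1 : U →ₗ[k] U) i j • b i := by
    intro j
    rw [← b.sum_repr (g.1 (b j))]
    simp [LinearMap.toMatrix_apply]
  have h10 : ω (b 1) (b 0) = - ω (b 0) (b 1) := (hω.neg_eq _ _).symm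
  rw [Matrix.det_fin_two] at hdet
  have key : ω (g.1 (b 0)) (g.1 (b 1)) = ω (b 0) (b 1) := by
    rw [hg, hg]
    simp only [Fin.sum_univ_two, map_add, map_smul, LinearMap.add_apply, LinearMap.smul_apply,
      smul_eq_mul, hω.self_eq_zero, h10]
    linear_combination (ω (b 0) (b 1)) * hdet
  have key' : ω (g.1 (b 1)) (g.1 (b 0)) = - ω (b 0) (b 1) := by
    rw [← hω.neg_eq, key]
  rw [← b.sum_repr u, ← b.sum_repr v]
  simp only [Fin.sum_univ_two, map_add, map_smul, LinearMap.add_apply, LinearMap.smul_apply,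
    smul_eq_mul, hω.self_eq_zero, key, key', h10]

theorem matchingTensor_mem [Finite L] [FiniteDimensional k U] (hU : Module.finrank k U = 2) {ω : LinearMap.BilinForm k U}
    (hω : ω.IsAlt) {m : ℕ} (Γ : Fin m × Fin 2 ≃ L) : matchingTensor ω Γ ∈ V k L U := by
  intro g
  apply (PiTensorProduct.dualDistribEquiv (ι := L) (R := k) (M := fun _ => U)).injective
  change PiTensorProduct.dualDistrib _ = PiTensorProduct.dualDistrib _
  rw [dualDistrib_map]
  ext u
  simp only [LinearMap.compMultilinearMap_apply, LinearMap.comp_apply, PiTensorProduct.map_tprod,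
    dualDistrib_matchingTensor]
  exact Finset.prod_congr rfl fun i _ => form_invariant hU hω g⁻¹ _ _

/-- `X_Γ` as an element of `V`. -/
def matchingElt [Finite L] [FiniteDimensional k U] (hU : Module.finrank k U = 2) {ω : LinearMap.BilinForm k U} (hω : ω.IsAlt)
    {m : ℕ} (Γ : Fin m × Fin 2 ≃ L) : V k L U :=
  ⟨matchingTensor ω Γ, matchingTensor_mem hU hω Γ⟩

end Matching

end EightPoints

end

open scoped TensorProduct

noncomputable section

namespace EightPoints

/-! ### Derivations of the symmetric algebra and the third polarization of a cubic. -/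

section SymmetricAlgebra

variable {k M : Type*} [Field k] [AddCommGroup M] [Module k M]

/-! A cubic `s` is studied through its polarization `polar s`, evaluated on the coordinates `coord b
χ` of V, where χ assigns to each of the eight points one of two basis vectors of U. Three labellings
place the points at vertices of the cube {0,1}³. Skewness kills the polarization as soon as two
points share a vertex, so only bijections onto the eight vertices survive. These form one orbit of
the symmetric group, hence for `s ≠ 0` all their values are nonzero
(`IsSkewInvariant.polar_ne_zero`).

Take two labellings that are constant on the edges of Γ and together separate the four edges. The
second derivative of `s` along them has nonzero coordinates only at transversals of Γ, and
SL(U)-invariance then makes it a nonzero multiple of X_Γ (`SupportedOn.exists_eq_smul`,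
`IsSkewInvariant.exists_polar_eq`). If A annihilates `s`, the identity `polar_glAction` at
well-chosen labellings isolates a single coordinate of A X_Γ at a non-transversal and shows that it
vanishes. So every X_Γ is an eigenvector of A (`IsSkewInvariant.exists_apply_eq_smul`).

A Plücker relation X = X' + X'' among eigenvectors, no two of them proportional, forces equal
eigenvalues. Such moves and reversals of edges connect all matchings, and the X_Γ span V
(`mem_of_matchingElt_mem`), so A is a scalar μ. Euler's identity gives A s = 3μ s, whence μ = 0.
Linear syzygies are the same thing as annihilating endomorphisms, because A s = ∑ A(xᵢ) ∂ᵢ s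
(`glAction_eq_sum`).

The skew-average of X_Γ³ is a skew-invariant cubic, so it only has to be nonzero. At a suitable
triple of labellings all nonvanishing terms of the average coincide, and nothing cancels
(`skewAverage_pow_three_ne_zero`). -/

open SymmetricAlgebra in
theorem partialDeriv_ι (φ : Module.Dual k M) (v : M) :
    partialDeriv φ (ι k M v) = algebraMap k _ (φ v) := by
  simp [partialDeriv]

open SymmetricAlgebra in
theorem glAction_ι (A : Module.End k M) (v : M) : glAction A (ι k M v) = ι k M (A v) := by
  simp [glAction]

theorem partialDeriv_add (φ ψ : Module.Dual k M) :
    partialDeriv (φ + ψ) = partialDeriv φ + partialDeriv ψ :=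
  derivation_ext fun v => by simp [partialDeriv_ι]

theorem partialDeriv_smul (c : k) (φ : Module.Dual k M) :
    partialDeriv (c • φ) = c • partialDeriv φ :=
  derivation_ext fun v => by simp [partialDeriv_ι, Algebra.smul_def]

/-- The partial derivative of a fixed element as a linear map in the direction. -/
def partialDerivₗ (s : SymmetricAlgebra k M) : Module.Dual k M →ₗ[k] SymmetricAlgebra k M where
  toFun φ := partialDeriv φ s
  map_add' φ ψ := by simp [partialDeriv_add]
  map_smul' c φ := by simp [partialDeriv_smul]

theorem partialDerivₗ_apply (s : SymmetricAlgebra k M) (φ : Module.Dual k M) :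
    partialDerivₗ s φ = partialDeriv φ s := rfl

theorem partialDeriv_comm (φ ψ : Module.Dual k M) (s : SymmetricAlgebra k M) :
    partialDeriv φ (partialDeriv ψ s) = partialDeriv ψ (partialDeriv φ s) := by
  have h : ⁅partialDeriv φ, partialDeriv ψ⁆ = 0 :=
    derivation_ext fun v => by simp [Derivation.commutator_apply, partialDeriv_ι]
  have h' := congrArg (fun D => D s) h
  simpa [Derivation.commutator_apply, sub_eq_zero] using h'

theorem partialDeriv_glAction (φ : Module.Dual k M) (A : Module.End k M)
    (s : SymmetricAlgebra k M) :
    partialDeriv φ (glAction A s) = glAction A (partialDeriv φ s) + partialDeriv (φ ∘ₗ A) s := by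
  have h : ⁅partialDeriv φ, glAction A⁆ = partialDeriv (φ ∘ₗ A) :=
    derivation_ext fun v => by
      simp [Derivation.commutator_apply, partialDeriv_ι, glAction_ι]
  have h' := congrArg (fun D => D s) h
  simp only [Derivation.commutator_apply] at h'
  rw [← h']
  abel

theorem algebraMapInv_glAction (A : Module.End k M) (s : SymmetricAlgebra k M) :
    SymmetricAlgebra.algebraMapInv (glAction A s) = 0 := by
  induction s using SymmetricAlgebra.induction with
  | algebraMap r => simp
  | ι x => rw [glAction_ι, SymmetricAlgebra.algebraMapInv_ι]
  | mul a b ha hb => simp [ha, hb]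
  | add a b ha hb => simp [ha, hb]

theorem algebraMapInv_algebraMap (c : k) :
    SymmetricAlgebra.algebraMapInv (algebraMap k (SymmetricAlgebra k M) c) = c :=
  SymmetricAlgebra.algebraMap_leftInverse M c

theorem partialDeriv_mem_symPow (φ : Module.Dual k M) (n : ℕ) :
    ∀ s ∈ symPow k M (n + 1), partialDeriv φ s ∈ symPow k M n := by
  induction n with
  | zero =>
    intro s hs
    rw [symPow, zero_add, pow_one] at hs
    obtain ⟨v, rfl⟩ := hs
    rw [partialDeriv_ι, symPow, pow_zero]
    exact Submodule.algebraMap_mem _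
  | succ n ih =>
    intro s hs
    rw [symPow, pow_succ] at hs
    refine Submodule.mul_induction_on hs ?_ ?_
    · rintro a ha _ ⟨v, rfl⟩
      rw [Derivation.leibniz, partialDeriv_ι]
      refine add_mem ?_ ?_
      · rw [smul_eq_mul, mul_comm, ← Algebra.smul_def]
        exact Submodule.smul_mem _ _ ha
      · rw [smul_eq_mul, mul_comm, symPow, pow_succ]
        exact Submodule.mul_mem_mul (ih a ha) ⟨v, rfl⟩
    · intro a b ha hb
      rw [map_add]
      exact add_mem ha hb

theorem glAction_one (n : ℕ) :
    ∀ s ∈ symPow k M n, glAction (1 : Module.End k M) s = (n : k) • s := by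
  induction n with
  | zero =>
    intro s hs
    rw [symPow, pow_zero, Submodule.mem_one] at hs
    obtain ⟨c, rfl⟩ := hs
    simp
  | succ n ih =>
    intro s hs
    rw [symPow, pow_succ] at hs
    refine Submodule.mul_induction_on hs ?_ ?_
    · rintro a ha _ ⟨v, rfl⟩
      rw [Derivation.leibniz, glAction_ι, ih a ha, smul_eq_mul, smul_eq_mul, Module.End.one_apply,
        mul_smul_comm, mul_comm a, Nat.cast_succ, add_smul, one_smul, add_comm]
    · intro a b ha hb
      rw [map_add, ha, hb, smul_add]

theorem derivation_sum_apply {I : Type*} (t : Finset I)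
    (D : I → Derivation k (SymmetricAlgebra k M) (SymmetricAlgebra k M))
    (s : SymmetricAlgebra k M) : (∑ i ∈ t, D i) s = ∑ i ∈ t, D i s := by
  have h := map_sum (Derivation.coeFnAddMonoidHom
    (R := k) (A := SymmetricAlgebra k M) (M := SymmetricAlgebra k M)) D t
  exact (congrFun h s).trans (Finset.sum_apply _ _ _)

/-- Both sides are derivations in `s`, so they need comparing only on M. This is the dictionary
between endomorphisms and linear syzygies. -/
theorem glAction_eq_sum {n : ℕ} (x : Module.Basis (Fin n) k M) (A : Module.End k M)
    (s : SymmetricAlgebra k M) :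
    glAction A s = ∑ i, SymmetricAlgebra.ι k M (A (x i)) * partialDeriv (x.coord i) s := by
  have h : glAction A = ∑ i, SymmetricAlgebra.ι k M (A (x i)) • partialDeriv (x.coord i) := by
    refine derivation_ext fun v => ?_
    rw [glAction_ι, derivation_sum_apply]
    conv_lhs => rw [← x.sum_repr v, map_sum, map_sum]
    simp [partialDeriv_ι, Algebra.smul_def, mul_comm]
  rw [h, derivation_sum_apply]
  simp

section Lie

attribute [local instance 100] LieRing.ofAssociativeRing

theorem noLinearSyzygies_of_annihilator_eq_bot {s : SymmetricAlgebra k M}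
    (hs : annihilator s = ⊥) {n : ℕ} (x : Module.Basis (Fin n) k M) : NoLinearSyzygies x s := by
  intro a ha h
  have ha' : ∀ i, ∃ v, SymmetricAlgebra.ι k M v = a i := fun i => by
    have := ha i
    rwa [symPow, pow_one] at this
  choose v hv using ha'
  have hA : (x.constr k v : Module.End k M) ∈ annihilator s := by
    change glAction _ s = 0
    rw [glAction_eq_sum x]
    simpa [hv] using h
  rw [hs, LieSubalgebra.mem_bot] at hA
  intro i
  rw [← hv i, ← x.constr_basis k v i, hA]
  simp

theorem annihilator_eq_bot {s : SymmetricAlgebra k M}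
    (h : ∀ A : Module.End k M, glAction A s = 0 → A = 0) : annihilator s = ⊥ := by
  rw [eq_bot_iff]
  intro A hA
  rw [LieSubalgebra.mem_bot]
  exact h A hA

end Lie

/-- Euler's identity recovers (n + 1) s from the first derivatives, and n + 1 is invertible in
characteristic zero. -/
theorem eq_zero_of_partialDeriv_eq_zero [CharZero k] [FiniteDimensional k M] {n : ℕ}
    {s : SymmetricAlgebra k M} (hs : s ∈ symPow k M (n + 1)) (h : ∀ φ, partialDeriv φ s = 0) :
    s = 0 := by
  have h1 := glAction_one (n + 1) s hs
  rw [glAction_eq_sum (Module.finBasis k M)] at h1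
  simp only [h, mul_zero, Finset.sum_const_zero] at h1
  exact (smul_eq_zero.1 h1.symm).resolve_left (Nat.cast_ne_zero.2 n.succ_ne_zero)

/-- The trilinear form on `M^*` of third partial derivatives of `s` at the origin. -/
def polar (s : SymmetricAlgebra k M) (φ ψ χ : Module.Dual k M) : k :=
  SymmetricAlgebra.algebraMapInv (partialDeriv φ (partialDeriv ψ (partialDeriv χ s)))

theorem polar_swap_left (s : SymmetricAlgebra k M) (φ ψ χ : Module.Dual k M) :
    polar s φ ψ χ = polar s ψ φ χ := by
  rw [polar, partialDeriv_comm, polar]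

theorem polar_swap_right (s : SymmetricAlgebra k M) (φ ψ χ : Module.Dual k M) :
    polar s φ ψ χ = polar s φ χ ψ := by
  rw [polar, partialDeriv_comm ψ, polar]

/-- Each ∂ moved past the derivation A leaves a commutator term, the derivative along the composite
with A. The remaining term has A outermost and so has no constant part. -/
theorem polar_glAction {s : SymmetricAlgebra k M} {A : Module.End k M} (hA : glAction A s = 0)
    (φ ψ χ : Module.Dual k M) :
    polar s (φ ∘ₗ A) ψ χ + polar s φ (ψ ∘ₗ A) χ + polar s φ ψ (χ ∘ₗ A) = 0 := by
  have h : SymmetricAlgebra.algebraMapInv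
      (partialDeriv φ (partialDeriv ψ (partialDeriv χ (glAction A s)))) = 0 := by simp [hA]
  simp only [partialDeriv_glAction, map_add, algebraMapInv_glAction] at h
  simp only [polar]
  linear_combination h

theorem exists_ι_eq_partialDeriv {s : SymmetricAlgebra k M} (hs : s ∈ symPow k M 3)
    (ψ χ : Module.Dual k M) :
    ∃ v : M, partialDeriv ψ (partialDeriv χ s) = SymmetricAlgebra.ι k M v ∧
      ∀ φ, polar s φ ψ χ = φ v := by
  have h := partialDeriv_mem_symPow ψ 1 _ (partialDeriv_mem_symPow χ 2 _ hs)
  rw [symPow, pow_one] at h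
  obtain ⟨v, hv⟩ := h
  exact ⟨v, hv.symm, fun φ => by rw [polar, ← hv, partialDeriv_ι, algebraMapInv_algebraMap]⟩

/-- Linear forms without a common nonzero zero span the dual, by double annihilators. This lets the
coordinates `coord b χ`, which are far from independent, serve as test functionals. -/
theorem eq_zero_of_forall_separating {N : Type*} [AddCommGroup N] [Module k N]
    [FiniteDimensional k M] {I : Type*} (e : I → Module.Dual k M)
    (he : ∀ v, (∀ i, e i v = 0) → v = 0) (f : Module.Dual k M →ₗ[k] N) (h : ∀ i, f (e i) = 0) :
    f = 0 := by
  have hspan : Submodule.span k (Set.range e) = ⊤ := by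
    rw [← Subspace.dualCoannihilator_dualAnnihilator_eq (W := Submodule.span k (Set.range e))]
    have : (Submodule.span k (Set.range e)).dualCoannihilator = ⊥ := by
      rw [eq_bot_iff]
      intro v hv
      rw [Submodule.mem_dualCoannihilator] at hv
      exact he v fun i => hv _ (Submodule.subset_span ⟨i, rfl⟩)
    rw [this, Submodule.dualAnnihilator_bot]
  exact LinearMap.ext_on_range hspan fun i => by simp [h]

theorem eq_zero_of_polar_eq_zero [CharZero k] [FiniteDimensional k M] {I : Type*}
    (e : I → Module.Dual k M) (he : ∀ v, (∀ i, e i v = 0) → v = 0)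
    {s : SymmetricAlgebra k M} (hs : s ∈ symPow k M 3)
    (h : ∀ i j l, polar s (e i) (e j) (e l) = 0) : s = 0 := by
  refine eq_zero_of_partialDeriv_eq_zero hs fun χ => ?_
  rw [← partialDerivₗ_apply, eq_zero_of_forall_separating e he (partialDerivₗ s) fun l => ?_]
  · rfl
  rw [partialDerivₗ_apply]
  refine eq_zero_of_partialDeriv_eq_zero (partialDeriv_mem_symPow _ 2 _ hs) fun ψ => ?_
  rw [← partialDerivₗ_apply, eq_zero_of_forall_separating e he (partialDerivₗ _) fun j => ?_]
  · rfl
  obtain ⟨v, hv, hv'⟩ := exists_ι_eq_partialDeriv hs (e j) (e l)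
  rw [partialDerivₗ_apply, hv, he v fun i => by rw [← hv', h], map_zero]

theorem polar_ι_pow_three (v : M) (φ ψ χ : Module.Dual k M) :
    polar (SymmetricAlgebra.ι k M v ^ 3) φ ψ χ = 6 * (φ v * ψ v * χ v) := by
  rw [polar, pow_succ, pow_two]
  simp only [Derivation.leibniz, partialDeriv_ι, map_add, smul_eq_mul, Derivation.map_algebraMap,
    map_mul, algebraMapInv_algebraMap, SymmetricAlgebra.algebraMapInv_ι, map_zero]
  ring

/-- The trilinear form of third derivatives depends linearly on the cubic. -/
def polarₗ (φ ψ χ : Module.Dual k M) : SymmetricAlgebra k M →ₗ[k] k where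
  toFun s := polar s φ ψ χ
  map_add' s t := by simp [polar]
  map_smul' c s := by simp [polar]

theorem polarₗ_apply (s : SymmetricAlgebra k M) (φ ψ χ : Module.Dual k M) :
    polarₗ φ ψ χ s = polar s φ ψ χ := rfl

theorem partialDeriv_lift (f : M →ₗ[k] M) (φ : Module.Dual k M) (s : SymmetricAlgebra k M) :
    partialDeriv φ (SymmetricAlgebra.lift (SymmetricAlgebra.ι k M ∘ₗ f) s) =
      SymmetricAlgebra.lift (SymmetricAlgebra.ι k M ∘ₗ f) (partialDeriv (φ ∘ₗ f) s) := by
  induction s using SymmetricAlgebra.induction with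
  | algebraMap r => simp
  | ι x => simp [partialDeriv_ι]
  | mul a b ha hb => simp [ha, hb]
  | add a b ha hb => simp [ha, hb]

theorem algebraMapInv_lift (f : M →ₗ[k] M) (s : SymmetricAlgebra k M) :
    SymmetricAlgebra.algebraMapInv (SymmetricAlgebra.lift (SymmetricAlgebra.ι k M ∘ₗ f) s) =
      SymmetricAlgebra.algebraMapInv s := by
  induction s using SymmetricAlgebra.induction with
  | algebraMap r => simp
  | ι x => simp [SymmetricAlgebra.algebraMapInv_ι]
  | mul a b ha hb => simp [ha, hb]
  | add a b ha hb => simp [ha, hb]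

theorem polar_lift (f : M →ₗ[k] M) (s : SymmetricAlgebra k M) (φ ψ χ : Module.Dual k M) :
    polar (SymmetricAlgebra.lift (SymmetricAlgebra.ι k M ∘ₗ f) s) φ ψ χ =
      polar s (φ ∘ₗ f) (ψ ∘ₗ f) (χ ∘ₗ f) := by
  simp only [polar, partialDeriv_lift, algebraMapInv_lift]

theorem lift_mem_symPow (f : M →ₗ[k] M) (n : ℕ) :
    ∀ s ∈ symPow k M n,
      SymmetricAlgebra.lift (SymmetricAlgebra.ι k M ∘ₗ f) s ∈ symPow k M n := by
  intro s hs
  have h : (symPow k M n).map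
      (SymmetricAlgebra.lift (SymmetricAlgebra.ι k M ∘ₗ f)).toLinearMap ≤ symPow k M n := by
    rw [symPow, Submodule.map_pow]
    refine pow_le_pow_left' ?_ n
    rintro _ ⟨_, ⟨v, rfl⟩, rfl⟩
    exact ⟨f v, by simp⟩
  exact h ⟨s, hs, rfl⟩

end SymmetricAlgebra

/-! ### Coordinates of invariant tensors: the weight condition and the unipotent relations. -/

section Coordinates

variable {k L U : Type*} [Field k] [AddCommGroup U] [Module k U]

/-- Evaluation of an invariant tensor, viewed as a multilinear form, at a family of vectors. -/
def evalAt [Finite L] (u : L → U) : Module.Dual k (V k L U) :=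
  ((LinearMap.applyₗ (PiTensorProduct.tprod k u)) ∘ₗ PiTensorProduct.dualDistrib) ∘ₗ
    (V k L U).subtype

theorem evalAt_apply [Finite L] (u : L → U) (t : V k L U) :
    evalAt u t = PiTensorProduct.dualDistrib t.1 (PiTensorProduct.tprod k u) := rfl

/-- An invariant tensor as a multilinear form. -/
def toForm [Finite L] (t : V k L U) : MultilinearMap k (fun _ : L => U) k :=
  (PiTensorProduct.dualDistrib t.1).compMultilinearMap (PiTensorProduct.tprod k)

theorem toForm_apply [Finite L] (u : L → U) (t : V k L U) : toForm t u = evalAt u t := rfl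

theorem evalAt_invariant [Finite L] (g : SpecialLinearGroup k U) (u : L → U) (t : V k L U) :
    evalAt (fun l => g.1 (u l)) t = evalAt u t := by
  have h := t.2 g⁻¹
  rw [inv_inv] at h
  rw [evalAt_apply, evalAt_apply]
  conv_rhs => rw [← h, dualDistrib_map, LinearMap.comp_apply, PiTensorProduct.map_tprod]
  rfl

theorem evalAt_comp_permV [Finite L] (σ : Equiv.Perm L) (u : L → U) :
    evalAt u ∘ₗ permV k U σ = evalAt (u ∘ σ) := by
  have := Fintype.ofFinite L
  have h : ∀ t : DualTensor k L U,
      PiTensorProduct.dualDistrib (PiTensorProduct.reindex k (fun _ : L => Module.Dual k U) σ t)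
        (PiTensorProduct.tprod k u) =
      PiTensorProduct.dualDistrib t (PiTensorProduct.tprod k (u ∘ σ)) := by
    intro t
    induction t using PiTensorProduct.induction_on with
    | smul_tprod r φ =>
      simp only [map_smul, PiTensorProduct.reindex_tprod, LinearMap.smul_apply,
        PiTensorProduct.dualDistrib_apply]
      congr 1
      rw [← Equiv.prod_comp σ]
      exact Finset.prod_congr rfl fun l _ =>
        congrArg (fun y => φ y (u (σ l))) (σ.symm_apply_apply l)
    | add a b ha hb => simp [ha, hb]
  exact LinearMap.ext fun t => h t.1

theorem evalAt_matchingElt [Finite L] [FiniteDimensional k U] (hU : Module.finrank k U = 2)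
    {ω : LinearMap.BilinForm k U} (hω : ω.IsAlt) {m : ℕ} (Γ : Fin m × Fin 2 ≃ L) (u : L → U) :
    evalAt u (matchingElt hU hω Γ) = ∏ i, ω (u (Γ (i, 0))) (u (Γ (i, 1))) :=
  dualDistrib_matchingTensor ω Γ u

/-- The coordinate of an invariant tensor at a family of vectors of a fixed basis of the plane. -/
def coord [Finite L] (b : Module.Basis (Fin 2) k U) (χ : L → Fin 2) : Module.Dual k (V k L U) :=
  evalAt (b ∘ χ)

theorem coord_comp_permV [Finite L] (b : Module.Basis (Fin 2) k U) (χ : L → Fin 2)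
    (σ : Equiv.Perm L) : coord b χ ∘ₗ permV k U σ = coord b (χ ∘ σ) :=
  evalAt_comp_permV σ _

theorem eq_zero_of_coord_eq_zero [Finite L] (b : Module.Basis (Fin 2) k U) (t : V k L U)
    (h : ∀ χ, coord b χ t = 0) : t = 0 := by
  have : FiniteDimensional k U := b.finiteDimensional_of_finite
  apply Subtype.ext
  apply (PiTensorProduct.dualDistribEquiv (ι := L) (R := k) (M := fun _ => U)).injective
  rw [ZeroMemClass.coe_zero, map_zero]
  change PiTensorProduct.dualDistrib _ = 0
  refine PiTensorProduct.ext (Module.Basis.ext_multilinear (fun _ => b) fun χ => ?_)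
  exact h χ

theorem exists_specialLinearGroup (b : Module.Basis (Fin 2) k U) (A : Matrix (Fin 2) (Fin 2) k)
    (hA : A.det = 1) : ∃ g : SpecialLinearGroup k U, ∀ j, g.1 (b j) = ∑ i, A i j • b i := by
  refine ⟨Matrix.SpecialLinearGroup.toLin_equiv b ⟨A, hA⟩, fun j => ?_⟩
  have h := Matrix.SpecialLinearGroup.toLin_equiv.toLinearMap_eq b ⟨A, hA⟩
  have h' := congrArg (fun f => f (b j)) h
  simp only [Matrix.toLin_self] at h'
  exact h'

variable [Fintype L]

/-- The torus element diag(2, 1/2) multiplies this coordinate by 2 to the power #0 − #1, and powers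
of 2 are distinct in characteristic zero. -/
theorem card_eq_of_coord_ne_zero [CharZero k] (b : Module.Basis (Fin 2) k U) {χ : L → Fin 2}
    {t : V k L U} (h : coord b χ t ≠ 0) {i j : Fin 2} (hij : i ≠ j) :
    (Finset.univ.filter fun l => χ l = i).card = (Finset.univ.filter fun l => χ l = j).card := by
  have key : (Finset.univ.filter fun l => χ l = 0).card =
      (Finset.univ.filter fun l => χ l = 1).card := by
    obtain ⟨g, hg⟩ := exists_specialLinearGroup b !![2, 0; 0, 2⁻¹] (by simp)
    have h0 : g.1 (b 0) = (2 : k) • b 0 := by simp [hg]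
    have h1 : g.1 (b 1) = (2⁻¹ : k) • b 1 := by simp [hg]
    have h2 := evalAt_invariant g (b ∘ χ) t
    have h3 : (fun l => g.1 ((b ∘ χ) l)) =
        fun l => (if χ l = 0 then (2 : k) else 2⁻¹) • (b ∘ χ) l := by
      funext l
      by_cases hl : χ l = 0
      · simp [hl, h0]
      · have hl' : χ l = 1 := by omega
        simp [hl', h1]
    rw [h3, ← toForm_apply, MultilinearMap.map_smul_univ, toForm_apply] at h2
    have h4 : (∏ l, if χ l = 0 then (2 : k) else 2⁻¹) = 1 := by
      apply mul_right_cancel₀ h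
      rw [one_mul]
      exact h2
    rw [Finset.prod_ite, Finset.prod_const, Finset.prod_const, inv_pow] at h4
    have h5 : (2 : k) ^ (Finset.univ.filter fun l => χ l = 0).card =
        2 ^ (Finset.univ.filter fun l => ¬ χ l = 0).card := by
      rwa [← div_eq_mul_inv, div_eq_one_iff_eq (pow_ne_zero _ two_ne_zero)] at h4
    have h6 := Nat.pow_right_injective le_rfl (by exact_mod_cast h5)
    rw [h6]
    congr 1
    ext l
    simp only [Finset.mem_filter, Finset.mem_univ, true_and]
    omega
  obtain rfl | rfl : i = 0 ∨ i = 1 := by omega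
  · obtain rfl : j = 1 := by omega
    exact key
  · obtain rfl : j = 0 := by omega
    exact key.symm

variable [DecidableEq L]

/-- Invariance under a nilpotent element of sl₂, obtained from the group: expand the action of a
transvection over subsets of the points labelled `i`. The weight condition leaves only singletons.
-/
theorem sum_coord_update [CharZero k] (b : Module.Basis (Fin 2) k U) (χ : L → Fin 2)
    {i j : Fin 2} (hij : i ≠ j) (t : V k L U) :
    ∑ l ∈ Finset.univ.filter (fun l => χ l = i), coord b (Function.update χ l j) t = 0 := by
  set Z := Finset.univ.filter (fun l => χ l = i) with hZ
  set O := Finset.univ.filter (fun l => χ l = j) with hO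
  have hdisj : ∀ l, ¬ χ l = i → χ l = j := fun l hl => by omega
  have hcard : ∀ s ⊆ Z, coord b (s.piecewise (fun _ => j) χ) t ≠ 0 →
      Z.card = O.card + 2 * s.card := by
    intro s hs hne
    have h := card_eq_of_coord_ne_zero b hne hij
    have h1 : (Finset.univ.filter fun l => s.piecewise (fun _ => j) χ l = i) = Z \ s := by
      ext l
      by_cases hl : l ∈ s <;> simp [hl, hZ, hij.symm]
    have h2 : (Finset.univ.filter fun l => s.piecewise (fun _ => j) χ l = j) = O ∪ s := by
      ext l
      by_cases hl : l ∈ s <;> simp [hl, hO]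
    have h3 : Disjoint O s := by
      rw [Finset.disjoint_left]
      intro l hl hl'
      have := hs hl'
      simp only [hZ, hO, Finset.mem_filter, Finset.mem_univ, true_and] at hl this
      exact hij (this.symm.trans hl)
    rw [h1, h2, Finset.card_sdiff_of_subset hs, Finset.card_union_of_disjoint h3] at h
    have := Finset.card_le_card hs
    omega
  have hupd : ∀ l, Function.update χ l j = ({l} : Finset L).piecewise (fun _ => j) χ := by
    intro l
    rw [Finset.piecewise_singleton]
  -- In any other weight each summand vanishes separately.
  by_cases hZO : Z.card = O.card + 2
  swap
  · refine Finset.sum_eq_zero fun l hl => ?_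
    by_contra hne
    rw [hupd] at hne
    exact hZO (by simpa using hcard {l} (by simpa using hl) hne)
  obtain ⟨g, hg⟩ := exists_specialLinearGroup b (Matrix.transvection j i 1)
    (Matrix.det_transvection_of_ne j i hij.symm 1)
  have hgi : g.1 (b i) = b j + b i := by
    rw [hg]
    fin_cases i <;> fin_cases j <;> simp_all [Matrix.transvection, Matrix.single_apply, add_comm]
  have hgj : g.1 (b j) = b j := by
    rw [hg]
    fin_cases i <;> fin_cases j <;> simp_all [Matrix.transvection, Matrix.single_apply]
  have h2 := evalAt_invariant g (b ∘ χ) t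
  have h3 : (fun l => g.1 ((b ∘ χ) l)) =
      (fun l => if χ l = i then b j else 0) + b ∘ χ := by
    funext l
    by_cases hl : χ l = i
    · simp [hl, hgi]
    · simp [hdisj l hl, hgj, hij.symm]
  have h4 : evalAt (b ∘ χ) t = 0 := by
    by_contra hne
    have : Z.card = O.card := card_eq_of_coord_ne_zero b hne hij
    omega
  rw [h3, h4, ← toForm_apply, MultilinearMap.map_add_univ] at h2
  have hterm : ∀ s ⊆ Z, s.piecewise (fun l => if χ l = i then b j else 0) (b ∘ χ) =
      b ∘ s.piecewise (fun _ => j) χ := by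
    intro s hs
    funext l
    by_cases hl : l ∈ s
    · have := hs hl
      simp only [hZ, Finset.mem_filter, Finset.mem_univ, true_and] at this
      simp [hl, this]
    · simp [hl]
  rw [← Finset.sum_subset
    (Finset.subset_univ (Z.map ⟨fun l => ({l} : Finset L), Finset.singleton_injective⟩)),
    Finset.sum_map] at h2
  · rw [← h2]
    refine Finset.sum_congr rfl fun l hl => ?_
    rw [hupd, Function.Embedding.coeFn_mk, hterm _ (by simpa using hl)]
    rfl
  · intro s _ hs
    by_cases hsZ : s ⊆ Z
    · rw [hterm s hsZ]
      by_contra hne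
      have := hcard s hsZ hne
      obtain ⟨l, rfl⟩ := Finset.card_eq_one.1 (by omega : s.card = 1)
      exact hs (Finset.mem_map.2 ⟨l, by simpa using hsZ, rfl⟩)
    · obtain ⟨l, hl, hl'⟩ := Finset.not_subset.1 hsZ
      refine MultilinearMap.map_coord_zero _ l ?_
      simp only [hZ, Finset.mem_filter, Finset.mem_univ, true_and] at hl'
      simp [hl, hl']

end Coordinates

/-! ### Tensors supported on the transversals of a matching are multiples of X_Γ. -/

section Transversals

variable {k L U : Type*} [Field k] [AddCommGroup U] [Module k U]

theorem coord_ext [Finite L] (b : Module.Basis (Fin 2) k U) {t t' : V k L U}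
    (h : ∀ χ, coord b χ t = coord b χ t') : t = t' := by
  rw [← sub_eq_zero]
  exact eq_zero_of_coord_eq_zero b _ fun χ => by rw [map_sub, h, sub_self]

theorem finiteDimensional_V [Finite L] (b : Module.Basis (Fin 2) k U) : FiniteDimensional k (V k L U) :=
  Module.Finite.of_injective (LinearMap.pi (coord b))
    ((injective_iff_map_eq_zero _).2 fun t ht => eq_zero_of_coord_eq_zero b t (congrFun ht))

theorem coord_permV [Finite L] (b : Module.Basis (Fin 2) k U) (χ : L → Fin 2)
    (σ : Equiv.Perm L) (t : V k L U) : coord b χ (permV k U σ t) = coord b (χ ∘ σ) t :=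
  congrArg (fun f => f t) (coord_comp_permV b χ σ)

theorem permV_permV [Finite L] (b : Module.Basis (Fin 2) k U) (σ τ : Equiv.Perm L) (t : V k L U) :
    permV k U σ (permV k U τ t) = permV k U (σ * τ) t :=
  coord_ext b fun χ => by
    rw [coord_permV, coord_permV, coord_permV, Equiv.Perm.coe_mul, Function.comp_assoc]

theorem permV_one [Finite L] (b : Module.Basis (Fin 2) k U) (t : V k L U) : permV k U 1 t = t :=
  coord_ext b fun χ => by rw [coord_permV, Equiv.Perm.coe_one, Function.comp_id]

theorem comp_swap_of_eq [DecidableEq L] {χ : L → Fin 2} {p q : L} (h : χ p = χ q) :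
    χ ∘ Equiv.swap p q = χ := by
  funext l
  rw [Function.comp_apply, Equiv.swap_apply_def]
  split_ifs with h1 h2 <;> simp_all

theorem comp_swap_eq_update [DecidableEq L] (χ : L → Fin 2) {p q : L} (hpq : p ≠ q) :
    χ ∘ Equiv.swap p q = Function.update (Function.update χ p (χ q)) q (χ p) := by
  funext l
  rw [Function.comp_apply, Equiv.swap_apply_def]
  by_cases h1 : l = p <;> by_cases h2 : l = q <;> simp_all

/-- A labelling by `0` and `1` which separates the ends of every edge of the matching. -/
def IsTransversal {m : ℕ} (Γ : Fin m × Fin 2 ≃ L) (χ : L → Fin 2) : Prop :=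
  ∀ i, χ (Γ (i, 0)) ≠ χ (Γ (i, 1))

/-- The invariant tensors all of whose coordinates off the transversals vanish. -/
def SupportedOn [Finite L] (b : Module.Basis (Fin 2) k U) {m : ℕ} (Γ : Fin m × Fin 2 ≃ L)
    (t : V k L U) : Prop :=
  ∀ χ, ¬ IsTransversal Γ χ → coord b χ t = 0

section MatchingElt

variable [Finite L] [FiniteDimensional k U] (hU : Module.finrank k U = 2)
  {ω : LinearMap.BilinForm k U} (hω : ω.IsAlt) {m : ℕ}

theorem coord_matchingElt (b : Module.Basis (Fin 2) k U) (Γ : Fin m × Fin 2 ≃ L) (χ : L → Fin 2) :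
    coord b χ (matchingElt hU hω Γ) = ∏ i, ω (b (χ (Γ (i, 0)))) (b (χ (Γ (i, 1)))) :=
  evalAt_matchingElt hU hω Γ _

theorem supportedOn_matchingElt (b : Module.Basis (Fin 2) k U) (Γ : Fin m × Fin 2 ≃ L) :
    SupportedOn b Γ (matchingElt hU hω Γ) := by
  intro χ hχ
  rw [IsTransversal] at hχ
  push Not at hχ
  obtain ⟨i, hi⟩ := hχ
  rw [coord_matchingElt]
  refine Finset.prod_eq_zero (Finset.mem_univ i) ?_
  rw [hi, hω.self_eq_zero]

theorem coord_matchingElt_ne_zero {b : Module.Basis (Fin 2) k U} (hb : ω (b 0) (b 1) ≠ 0)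
    {Γ : Fin m × Fin 2 ≃ L} {χ : L → Fin 2} (hχ : IsTransversal Γ χ) :
    coord b χ (matchingElt hU hω Γ) ≠ 0 := by
  have h10 : ω (b 1) (b 0) ≠ 0 := by
    rw [← hω.neg_eq]
    exact neg_ne_zero.2 hb
  rw [coord_matchingElt, Finset.prod_ne_zero_iff]
  intro i _
  have := hχ i
  generalize χ (Γ (i, 0)) = x at *
  generalize χ (Γ (i, 1)) = y at *
  obtain rfl | rfl : x = 0 ∨ x = 1 := by omega
  · obtain rfl : y = 1 := by omega
    exact hb
  · obtain rfl : y = 0 := by omega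
    exact h10

end MatchingElt

variable [CharZero k] [Fintype L] [DecidableEq L]

/-- Off the transversals both sides are zero. At a transversal this is a relation `sum_coord_update`
with all but two terms missing. -/
theorem SupportedOn.coord_comp_swap {b : Module.Basis (Fin 2) k U} {m : ℕ}
    {Γ : Fin m × Fin 2 ≃ L} {t : V k L U} (ht : SupportedOn b Γ t) (χ : L → Fin 2) (i : Fin m) :
    coord b (χ ∘ Equiv.swap (Γ (i, 0)) (Γ (i, 1))) t = - coord b χ t := by
  have hne : Γ (i, 0) ≠ Γ (i, 1) := by simp
  have hΓ : ∀ j, j ≠ i → ∀ c d, Γ (j, c) ≠ Γ (i, d) := fun j hj c d => by simp [hj]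
  by_cases hi : χ (Γ (i, 0)) = χ (Γ (i, 1))
  · rw [comp_swap_of_eq hi, ht χ fun h => h i hi, neg_zero]
  by_cases hχ : IsTransversal Γ χ
  swap
  · have hχ' := hχ
    rw [IsTransversal] at hχ'
    push Not at hχ'
    obtain ⟨j, hj⟩ := hχ'
    have hji : j ≠ i := fun h => hi (h ▸ hj)
    rw [ht χ hχ, neg_zero]
    refine ht _ fun h => h j ?_
    simp only [Function.comp_apply]
    rw [Equiv.swap_apply_of_ne_of_ne (hΓ j hji _ _) (hΓ j hji _ _),
      Equiv.swap_apply_of_ne_of_ne (hΓ j hji _ _) (hΓ j hji _ _), hj]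
  set p := Γ (i, 0) with hp
  set q := Γ (i, 1) with hq
  -- T gives both ends of edge `i` the label of `p`. Relabelling `q` or `p` in it yields χ or its
  -- swap; relabelling a point of another edge makes that edge constant, so the coordinate is zero.
  set T := Function.update χ q (χ p) with hT
  have hrel := sum_coord_update b T hi t
  rw [← Finset.sum_subset (s₁ := {p, q}), Finset.sum_pair hne] at hrel
  · have h1 : Function.update T q (χ q) = χ := by simp [hT]
    have h2 : Function.update T p (χ q) = χ ∘ Equiv.swap p q := by
      rw [Equiv.swap_comm, comp_swap_eq_update χ hne.symm]
    rw [h1, h2] at hrel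
    exact eq_neg_of_add_eq_zero_left hrel
  · intro l hl
    rw [Finset.mem_insert, Finset.mem_singleton] at hl
    obtain rfl | rfl := hl <;> simp [hT, hne]
  · intro l hl hl'
    rw [Finset.mem_insert, Finset.mem_singleton, not_or] at hl'
    obtain ⟨⟨j, c⟩, rfl⟩ := Γ.surjective l
    have hTl : χ (Γ (j, c)) = χ p := by
      simpa [hT, hl'.2] using hl
    have hji : j ≠ i := by
      rintro rfl
      obtain rfl | rfl : c = 0 ∨ c = 1 := by omega
      · exact hl'.1 rfl
      · exact hl'.2 rfl
    refine ht _ fun h => h j ?_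
    have hj := hχ j
    have hTj : ∀ d, T (Γ (j, d)) = χ (Γ (j, d)) := fun d => by
      rw [hT, Function.update_of_ne (hΓ j hji _ _)]
    obtain rfl | rfl : c = 0 ∨ c = 1 := by omega
    · rw [Function.update_self, Function.update_of_ne (by simp), hTj]
      omega
    · rw [Function.update_self, Function.update_of_ne (by simp), hTj]
      omega

/-- Flipping edges one at a time connects all transversals and changes the coordinate only by a
sign, so one coordinate determines the tensor. -/
theorem SupportedOn.eq_zero {b : Module.Basis (Fin 2) k U} {m : ℕ}
    {Γ : Fin m × Fin 2 ≃ L} {t : V k L U} (ht : SupportedOn b Γ t)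
    (h0 : coord b (fun l => (Γ.symm l).2) t = 0) : t = 0 := by
  refine eq_zero_of_coord_eq_zero b t fun χ => ?_
  have key : ∀ (D : Finset (Fin m)) (χ : L → Fin 2), IsTransversal Γ χ →
      (∀ i, i ∉ D → χ (Γ (i, 0)) = 0) → coord b χ t = 0 := by
    intro D
    induction D using Finset.induction_on with
    | empty =>
      intro χ hχ hD
      convert h0 using 2
      congr 1
      funext l
      obtain ⟨⟨i, c⟩, rfl⟩ := Γ.surjective l
      have h1 := hχ i
      have h2 := hD i (Finset.notMem_empty i)
      rw [Equiv.symm_apply_apply]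
      obtain rfl | rfl : c = 0 ∨ c = 1 := by omega
      · exact h2
      · simp only
        omega
    | insert i D hi ih =>
      intro χ hχ hD
      have hne : Γ (i, 0) ≠ Γ (i, 1) := by simp
      have hΓ : ∀ j, j ≠ i → ∀ c, Equiv.swap (Γ (i, 0)) (Γ (i, 1)) (Γ (j, c)) = Γ (j, c) :=
        fun j hj c => Equiv.swap_apply_of_ne_of_ne (by simp [hj]) (by simp [hj])
      by_cases hi0 : χ (Γ (i, 0)) = 0
      · refine ih χ hχ fun j hj => ?_
        by_cases hji : j = i
        · rw [hji, hi0]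
        · exact hD j (by simp [hji, hj])
      · rw [← neg_eq_zero, ← ht.coord_comp_swap χ i]
        refine ih _ (fun j => ?_) fun j hj => ?_
        · by_cases hji : j = i
          · subst hji
            simpa using (hχ j).symm
          · simp only [Function.comp_apply, hΓ j hji]
            exact hχ j
        · by_cases hji : j = i
          · subst hji
            have := hχ j
            simp only [Function.comp_apply, Equiv.swap_apply_left]
            omega
          · simp only [Function.comp_apply, hΓ j hji]
            exact hD j (by simp [hji, hj])
  by_cases hχ : IsTransversal Γ χ
  · exact key Finset.univ χ hχ fun i hi => absurd (Finset.mem_univ i) hi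
  · exact ht χ hχ

theorem SupportedOn.exists_eq_smul [FiniteDimensional k U] (hU : Module.finrank k U = 2)
    {ω : LinearMap.BilinForm k U} (hω : ω.IsAlt) {b : Module.Basis (Fin 2) k U}
    (hb : ω (b 0) (b 1) ≠ 0) {m : ℕ} {Γ : Fin m × Fin 2 ≃ L} {t : V k L U}
    (ht : SupportedOn b Γ t) : ∃ c : k, t = c • matchingElt hU hω Γ := by
  set χ₀ : L → Fin 2 := fun l => (Γ.symm l).2 with hχ₀
  have h0 : coord b χ₀ (matchingElt hU hω Γ) ≠ 0 :=
    coord_matchingElt_ne_zero hU hω hb fun i => by simp [hχ₀]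
  refine ⟨coord b χ₀ t / coord b χ₀ (matchingElt hU hω Γ), sub_eq_zero.1 ?_⟩
  refine SupportedOn.eq_zero (b := b) (Γ := Γ) (fun χ hχ => ?_) ?_
  · rw [map_sub, map_smul, ht χ hχ, supportedOn_matchingElt hU hω b Γ χ hχ, smul_zero, sub_zero]
  · rw [map_sub, map_smul, smul_eq_mul, div_mul_cancel₀ _ h0, sub_self]

end Transversals

/-! ### The elements X_Γ span the invariants. -/

section Spanning

variable {k L U : Type*} [Field k] [AddCommGroup U] [Module k U]
variable [CharZero k] [Fintype L] [DecidableEq L]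

/-- This writes a tensor antisymmetric along the first `r` edges through tensors that are also
antisymmetric in one more pair `(a, l)`. In a balanced coordinate, `m - r` points `l` beyond those
edges carry the label opposite to that of `a`; the swapped terms add up to minus the coordinate,
which accounts for the extra 1. -/
theorem sum_sub_permV_swap (b : Module.Basis (Fin 2) k U) {m r : ℕ} (hr : r < m)
    (Γ : Fin m × Fin 2 ≃ L) (t : V k L U)
    (ht : ∀ i : Fin m, i.val < r → permV k U (Equiv.swap (Γ (i, 0)) (Γ (i, 1))) t = - t) :
    ∑ l ∈ Finset.univ.filter (fun l => r ≤ (Γ.symm l).1.val),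
      (t - permV k U (Equiv.swap (Γ (⟨r, hr⟩, 0)) l) t) = ((m - r + 1 : ℕ) : k) • t := by
  set a := Γ (⟨r, hr⟩, 0) with ha
  refine coord_ext b fun χ => ?_
  have hflip : ∀ (χ : L → Fin 2) (i : Fin m), i.val < r → χ (Γ (i, 0)) = χ (Γ (i, 1)) →
      coord b χ t = 0 := by
    intro χ i hi h
    have h1 := congrArg (coord b χ) (ht i hi)
    rw [coord_permV, comp_swap_of_eq h, map_neg] at h1
    exact self_eq_neg.1 h1
  rw [map_sum, map_smul, smul_eq_mul]
  simp only [map_sub, coord_permV]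
  have hswap : ∀ (i : Fin m) (c : Fin 2) (l : L), i.val < r → r ≤ (Γ.symm l).1.val →
      Equiv.swap a l (Γ (i, c)) = Γ (i, c) := by
    intro i c l hi hl
    refine Equiv.swap_apply_of_ne_of_ne ?_ ?_
    · rw [ha]
      intro h
      have := congrArg (fun z => z.1.val) (Γ.injective h)
      simp only at this
      omega
    · rintro rfl
      simp only [Equiv.symm_apply_apply] at hl
      omega
  by_cases htr : ∃ i : Fin m, i.val < r ∧ χ (Γ (i, 0)) = χ (Γ (i, 1))
  · obtain ⟨i, hi, h⟩ := htr
    rw [hflip χ i hi h, mul_zero]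
    refine Finset.sum_eq_zero fun l hl => ?_
    rw [hflip _ i hi, sub_zero]
    simp only [Finset.mem_filter, Finset.mem_univ, true_and] at hl
    simp only [Function.comp_apply, hswap i _ l hi hl, h]
  push Not at htr
  by_cases hbal : ∃ χ', (Finset.univ.filter fun l => χ' l = χ a).card =
      (Finset.univ.filter fun l => χ l = χ a).card ∧ coord b χ' t ≠ 0
  swap
  · push Not at hbal
    rw [hbal χ rfl, mul_zero]
    refine Finset.sum_eq_zero fun l hl => ?_
    rw [hbal, sub_zero]
    refine Finset.card_bij (fun x _ => Equiv.swap a l x) ?_ ?_ ?_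
    · intro x hx
      simpa using hx
    · intro x _ y _ h
      exact (Equiv.swap a l).injective h
    · intro x hx
      exact ⟨Equiv.swap a l x, by simpa using hx, by simp⟩
  obtain ⟨χ', hχ', hne'⟩ := hbal
  obtain ⟨j, hj⟩ : ∃ j, j ≠ χ a := exists_ne _
  have hj' : ∀ x, x ≠ χ a ↔ x = j := fun x => by omega
  have hcardL : Fintype.card L = 2 * m := by
    rw [← Fintype.card_congr Γ, Fintype.card_prod, Fintype.card_fin, Fintype.card_fin, mul_comm]
  have hcompl : ∀ χ : L → Fin 2, ∀ x y : Fin 2, x ≠ y →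
      (Finset.univ.filter fun l => χ l = x).card + (Finset.univ.filter fun l => χ l = y).card =
        2 * m := by
    intro χ x y hxy
    rw [← hcardL, ← Finset.card_univ,
      ← Finset.card_filter_add_card_filter_not (s := Finset.univ) (fun l => χ l = x)]
    congr 2
    ext l
    simp only [Finset.mem_filter, Finset.mem_univ, true_and]
    omega
  have hm : (Finset.univ.filter fun l => χ l = j).card = m := by
    have h1 := hcompl χ j (χ a) hj
    have h2 := hcompl χ' j (χ a) hj
    have h3 := card_eq_of_coord_ne_zero b hne' hj
    omega
  set N := Finset.univ.filter (fun l => χ l = j ∧ r ≤ (Γ.symm l).1.val) with hN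
  have hNcard : N.card = m - r := by
    have h1 : (Finset.univ.filter fun l => χ l = j ∧ (Γ.symm l).1.val < r).card = r := by
      rw [Finset.card_filter, ← Γ.sum_comp, Fintype.sum_prod_type]
      have h2 : ∀ i : Fin m, (∑ c : Fin 2,
          if χ (Γ (i, c)) = j ∧ (Γ.symm (Γ (i, c))).1.val < r then 1 else 0) =
          if i.val < r then 1 else 0 := by
        intro i
        simp only [Equiv.symm_apply_apply]
        by_cases hi : i.val < r
        · have h3 := htr i hi
          rw [Fin.sum_univ_two]
          by_cases h4 : χ (Γ (i, 0)) = j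
          · have h5 : χ (Γ (i, 1)) ≠ j := fun h => h3 (h4.trans h.symm)
            simp [hi, h4, h5]
          · have h5 : χ (Γ (i, 1)) = j := by omega
            simp [hi, h4, h5]
        · simp [hi]
      rw [Finset.sum_congr rfl fun i _ => h2 i, ← Finset.card_filter, Fin.card_filter_val_lt]
      exact min_eq_right hr.le
    have h2 := Finset.card_filter_add_card_filter_not
      (s := Finset.univ.filter fun l => χ l = j) (fun l => (Γ.symm l).1.val < r)
    rw [Finset.filter_filter, Finset.filter_filter, h1, hm] at h2
    simp only [not_lt] at h2
    rw [hN]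
    omega
  have haN : r ≤ (Γ.symm a).1.val := by simp [ha]
  -- The term at `a` restores χ, and the term at a point of N gives χ with that point and `a`
  -- swapped.
  have hrel := sum_coord_update b (Function.update χ a j) hj t
  have hsum : ∑ l ∈ N, coord b (χ ∘ Equiv.swap a l) t = - coord b χ t := by
    rw [← Finset.sum_subset (s₁ := insert a N), Finset.sum_insert] at hrel
    · rw [Function.update_idem, Function.update_eq_self] at hrel
      rw [eq_neg_iff_add_eq_zero, add_comm, ← hrel]
      congr 1
      refine Finset.sum_congr rfl fun l hl => ?_
      simp only [hN, Finset.mem_filter, Finset.mem_univ, true_and] at hl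
      have hal : a ≠ l := by
        rintro rfl
        exact hj hl.1.symm
      rw [comp_swap_eq_update χ hal, hl.1]
    · simp [hN, hj.symm]
    · intro l hl
      rw [Finset.mem_insert] at hl
      obtain rfl | hl := hl
      · simp
      · simp only [hN, Finset.mem_filter, Finset.mem_univ, true_and] at hl ⊢
        by_cases hla : l = a
        · simp [hla]
        · simp [hla, hl.1]
    -- Such a point lies on one of the first `r` edges, whose ends receive equal labels, so
    -- antisymmetry kills the term.
    · intro l hl hl'
      rw [Finset.mem_insert, not_or] at hl'
      simp only [hN, Finset.mem_filter, Finset.mem_univ, true_and, Function.update_of_ne hl'.1,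
        not_and, not_le] at hl hl'
      have hlr := hl'.2 hl
      obtain ⟨⟨i, c⟩, rfl⟩ := Γ.surjective l
      simp only [Equiv.symm_apply_apply] at hlr
      have hia : ∀ d, Γ (i, d) ≠ a := by
        intro d h
        rw [← h, Equiv.symm_apply_apply] at haN
        simp only at haN
        omega
      have h3 := htr i hlr
      refine hflip _ i hlr ?_
      obtain rfl | rfl : c = 0 ∨ c = 1 := by omega
      · rw [Function.update_self, Function.update_of_ne (by simp), Function.update_of_ne (hia 1)]
        omega
      · rw [Function.update_self, Function.update_of_ne (by simp), Function.update_of_ne (hia 0)]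
        omega
  rw [← Finset.sum_subset (s₁ := N), Finset.sum_sub_distrib, hsum, Finset.sum_const, hNcard]
  · push_cast
    rw [nsmul_eq_mul]
    ring
  · intro l hl
    simp only [hN, Finset.mem_filter, Finset.mem_univ, true_and] at hl ⊢
    exact hl.2
  · intro l hl hl'
    simp only [hN, Finset.mem_filter, Finset.mem_univ, true_and] at hl hl'
    have hla : χ a = χ l := by
      by_contra h
      exact hl' ⟨(hj' _).1 (Ne.symm h), hl⟩
    rw [comp_swap_of_eq hla, sub_self]

/-- The invariants are spanned by the elements attached to matchings. -/
theorem mem_of_matchingElt_mem [FiniteDimensional k U] (hU : Module.finrank k U = 2)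
    {ω : LinearMap.BilinForm k U} (hω : ω.IsAlt) {b : Module.Basis (Fin 2) k U}
    (hb : ω (b 0) (b 1) ≠ 0) {m : ℕ} (Γ₀ : Fin m × Fin 2 ≃ L) (W : Submodule k (V k L U))
    (hW : ∀ Γ : Fin m × Fin 2 ≃ L, matchingElt hU hω Γ ∈ W) (t : V k L U) : t ∈ W := by
  -- Here `n` counts the edges along which antisymmetry is still missing. At `n = 0` the tensor is
  -- supported on transversals.
  have key : ∀ n r : ℕ, r + n = m → ∀ (Γ : Fin m × Fin 2 ≃ L) (t : V k L U),
      (∀ i : Fin m, i.val < r → permV k U (Equiv.swap (Γ (i, 0)) (Γ (i, 1))) t = - t) →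
        t ∈ W := by
    intro n
    induction n with
    | zero =>
      intro r hr Γ t ht
      have hsupp : SupportedOn b Γ t := by
        intro χ hχ
        rw [IsTransversal] at hχ
        push Not at hχ
        obtain ⟨i, hi⟩ := hχ
        have h1 := congrArg (coord b χ) (ht i (by omega))
        rw [coord_permV, comp_swap_of_eq hi, map_neg] at h1
        exact self_eq_neg.1 h1
      obtain ⟨c, rfl⟩ := hsupp.exists_eq_smul hU hω hb
      exact W.smul_mem c (hW Γ)
    | succ n ih =>
      intro r hr Γ t ht
      have hrm : r < m := by omega
      have hsum := sum_sub_permV_swap b hrm Γ t ht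
      have hc : ((m - r + 1 : ℕ) : k) ≠ 0 := Nat.cast_ne_zero.2 (by omega)
      rw [← inv_smul_smul₀ hc t, ← hsum]
      refine W.smul_mem _ (W.sum_mem fun l hl => ?_)
      set a := Γ (⟨r, hrm⟩, 0) with ha
      simp only [Finset.mem_filter, Finset.mem_univ, true_and] at hl
      by_cases hal : l = a
      · rw [hal, Equiv.swap_self, ← Equiv.Perm.one_def, permV_one b, sub_self]
        exact W.zero_mem
      have hne : ∀ i : Fin m, i.val < r → ∀ c, Γ (i, c) ≠ l ∧ Γ (i, c) ≠ a ∧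
          Γ (i, c) ≠ Γ (⟨r, hrm⟩, 1) := by
        intro i hi c
        have hir : i ≠ ⟨r, hrm⟩ := by
          rintro rfl
          exact lt_irrefl _ hi
        refine ⟨?_, ?_, ?_⟩
        · rintro rfl
          simp only [Equiv.symm_apply_apply] at hl
          omega
        · simp [ha, hir]
        · simp [hir]
      -- The new matching has `(a, l)` as its edge number `r` and keeps all earlier edges.
      refine ih (r + 1) (by omega) (Γ.trans (Equiv.swap l (Γ (⟨r, hrm⟩, 1)))) _ fun i hi => ?_
      simp only [Equiv.trans_apply]
      by_cases hir : i.val < r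
      · rw [Equiv.swap_apply_of_ne_of_ne (hne i hir 0).1 (hne i hir 0).2.2,
          Equiv.swap_apply_of_ne_of_ne (hne i hir 1).1 (hne i hir 1).2.2, map_sub,
          permV_permV b]
        have hcomm : Equiv.swap (Γ (i, 0)) (Γ (i, 1)) * Equiv.swap a l =
            Equiv.swap a l * Equiv.swap (Γ (i, 0)) (Γ (i, 1)) := by
          rw [Equiv.mul_swap_eq_swap_mul (Equiv.swap (Γ (i, 0)) (Γ (i, 1))) a l,
            Equiv.swap_apply_of_ne_of_ne (hne i hir 0).2.1.symm (hne i hir 1).2.1.symm,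
            Equiv.swap_apply_of_ne_of_ne (hne i hir 0).1.symm (hne i hir 1).1.symm]
        rw [hcomm, ← permV_permV b, ht i hir, map_neg]
        abel
      · obtain rfl : i = ⟨r, hrm⟩ := Fin.ext (by simp only; omega)
        rw [Equiv.swap_apply_right, ← ha,
          Equiv.swap_apply_of_ne_of_ne (Ne.symm hal) (by simp [ha]), map_sub, permV_permV b,
          Equiv.swap_mul_self, permV_one b]
        abel
  exact key m 0 (by omega) Γ₀ t fun i hi => absurd hi (by omega)

end Spanning

/-! ### Labellings constant on edges, and their finite combinatorics. -/

section Labels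

variable {L : Type*}

/-- The labelling of `L` which is constant on the edges of a matching, with prescribed values. -/
def edgeLabel {m : ℕ} (Γ : Fin m × Fin 2 ≃ L) (P : Fin m → Fin 2) (l : L) : Fin 2 :=
  P (Γ.symm l).1

theorem edgeLabel_apply {m : ℕ} (Γ : Fin m × Fin 2 ≃ L) (P : Fin m → Fin 2) (i : Fin m)
    (c : Fin 2) : edgeLabel Γ P (Γ (i, c)) = P i := by
  simp [edgeLabel]

theorem injective_edge_pair : ∀ i j l : Fin 4, i ≠ j → i ≠ l → j ≠ l →
    Function.Injective fun x : Fin 4 =>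
      ((if x = i ∨ x = j then 0 else 1 : Fin 2), (if x = i ∨ x = l then 0 else 1 : Fin 2)) := by
  decide

/-- Both fibres of P have two elements; the second labelling splits each of them. -/
theorem exists_injective_pair : ∀ P : Fin 4 → Fin 2, (∑ i, (P i).val) = 2 →
    ∃ i j : Fin 4, Function.Injective fun x => (P x, (if x = i ∨ x = j then 0 else 1 : Fin 2)) := by
  decide

theorem exists_ne_apply_eq : ∀ P : Fin 4 → Fin 2, ∃ i j : Fin 4, i ≠ j ∧ P i = P j := by
  decide

end Labels

theorem sum_val_eq_of_coord_ne_zero {k L U : Type*} [Field k] [CharZero k] [AddCommGroup U]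
    [Module k U] [Fintype L] {b : Module.Basis (Fin 2) k U} (Γ : Fin 4 × Fin 2 ≃ L)
    {χ : L → Fin 2} {t : V k L U} (h : coord b χ t ≠ 0) :
    ∑ i, ((χ (Γ (i, 0))).val + (χ (Γ (i, 1))).val) = 4 := by
  have hL : Fintype.card L = 8 := by rw [← Fintype.card_congr Γ]; simp
  have h1 := card_eq_of_coord_ne_zero b h zero_ne_one
  have h2 := Finset.card_filter_add_card_filter_not (s := Finset.univ) (fun l => χ l = 0)
  rw [Finset.card_univ, hL] at h2
  have h3 : (Finset.univ.filter fun l => ¬ χ l = 0) = Finset.univ.filter fun l => χ l = 1 := by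
    ext l
    simp only [Finset.mem_filter, Finset.mem_univ, true_and]
    omega
  have h4 : ∑ i, ((χ (Γ (i, 0))).val + (χ (Γ (i, 1))).val) = ∑ l, (χ l).val := by
    rw [← Γ.sum_comp, Fintype.sum_prod_type]
    exact Finset.sum_congr rfl fun i _ => (Fin.sum_univ_two fun c => (χ (Γ (i, c))).val).symm
  have h5 : ∑ l, (χ l).val = (Finset.univ.filter fun l => χ l = 1).card := by
    rw [Finset.card_filter]
    refine Finset.sum_congr rfl fun l _ => ?_
    split_ifs with h
    · simp [h]
    · have : χ l = 0 := by omega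
      simp [this]
  rw [h3] at h2
  rw [h4, h5]
  omega

/-! ### Polarizations of skew-invariant cubics and their annihilating endomorphisms. -/

section SkewCubics

variable {k L U : Type*} [Field k] [AddCommGroup U] [Module k U] [Fintype L] [DecidableEq L]
  {s : SymmetricAlgebra k (V k L U)}

theorem IsSkewInvariant.polar_comp (hs : IsSkewInvariant s) (b : Module.Basis (Fin 2) k U)
    (σ : Equiv.Perm L) (χ₁ χ₂ χ₃ : L → Fin 2) :
    polar s (coord b (χ₁ ∘ σ)) (coord b (χ₂ ∘ σ)) (coord b (χ₃ ∘ σ)) =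
      ((Equiv.Perm.sign σ : ℤ) : k) * polar s (coord b χ₁) (coord b χ₂) (coord b χ₃) := by
  have h := congrArg (fun s => polarₗ (coord b χ₁) (coord b χ₂) (coord b χ₃) s) (hs σ)
  simp only [map_zsmul, polarₗ_apply] at h
  rw [permSym, polar_lift, coord_comp_permV, coord_comp_permV, coord_comp_permV,
    zsmul_eq_mul] at h
  exact h

variable [CharZero k]

/-- The transposition of `p` and `q` fixes all three labellings but has sign −1. -/
theorem IsSkewInvariant.polar_eq_zero (hs : IsSkewInvariant s) (b : Module.Basis (Fin 2) k U)
    {χ₁ χ₂ χ₃ : L → Fin 2} {p q : L} (hpq : p ≠ q) (h₁ : χ₁ p = χ₁ q) (h₂ : χ₂ p = χ₂ q)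
    (h₃ : χ₃ p = χ₃ q) : polar s (coord b χ₁) (coord b χ₂) (coord b χ₃) = 0 := by
  have h := hs.polar_comp b (Equiv.swap p q) χ₁ χ₂ χ₃
  rw [comp_swap_of_eq h₁, comp_swap_of_eq h₂, comp_swap_of_eq h₃, Equiv.Perm.sign_swap hpq] at h
  push_cast at h
  rw [neg_one_mul] at h
  exact self_eq_neg.1 h

/-- A labelling of `L` by vertices of the cube. -/
def cubeLabel (χ₁ χ₂ χ₃ : L → Fin 2) (l : L) : Fin 2 × Fin 2 × Fin 2 := (χ₁ l, χ₂ l, χ₃ l)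

theorem IsSkewInvariant.polar_ne_zero (hs : IsSkewInvariant s) (hL : Fintype.card L = 8)
    (hs3 : s ∈ symPow k (V k L U) 3) (hs0 : s ≠ 0) (b : Module.Basis (Fin 2) k U)
    {χ₁ χ₂ χ₃ : L → Fin 2} (hχ : Function.Injective (cubeLabel χ₁ χ₂ χ₃)) :
    polar s (coord b χ₁) (coord b χ₂) (coord b χ₃) ≠ 0 := by
  have := finiteDimensional_V (L := L) b
  have hex : ∃ η₁ η₂ η₃, polar s (coord b η₁) (coord b η₂) (coord b η₃) ≠ 0 := by
    by_contra hcon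
    push Not at hcon
    exact hs0 (eq_zero_of_polar_eq_zero (coord b) (eq_zero_of_coord_eq_zero b) hs3 hcon)
  obtain ⟨η₁, η₂, η₃, hη⟩ := hex
  have hinj : Function.Injective (cubeLabel η₁ η₂ η₃) := by
    intro p q hpq
    by_contra hne
    simp only [cubeLabel, Prod.mk.injEq] at hpq
    exact hη (hs.polar_eq_zero b hne hpq.1 hpq.2.1 hpq.2.2)
  have hcard : Fintype.card L = Fintype.card (Fin 2 × Fin 2 × Fin 2) := by simp [hL]
  -- Two bijections from L to the cube differ by a permutation of L, which changes the polarization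
  -- only by a sign.
  let e₁ := Equiv.ofBijective _ ((Fintype.bijective_iff_injective_and_card _).2 ⟨hinj, hcard⟩)
  let e₂ := Equiv.ofBijective _ ((Fintype.bijective_iff_injective_and_card _).2 ⟨hχ, hcard⟩)
  have hσ : ∀ l, cubeLabel χ₁ χ₂ χ₃ ((e₁.trans e₂.symm) l) = cubeLabel η₁ η₂ η₃ l :=
    fun l => e₂.apply_symm_apply (e₁ l)
  intro h0
  have h := hs.polar_comp b (e₁.trans e₂.symm) χ₁ χ₂ χ₃
  rw [h0, mul_zero] at h
  apply hη
  rw [← h]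
  congr 2 <;> funext l <;> have := hσ l <;> simp only [cubeLabel, Prod.mk.injEq] at this
  · exact this.1.symm
  · exact this.2.1.symm
  · exact this.2.2.symm

/-- By pigeonhole any third labelling agrees on two of the three points. Since coordinates separate
V, the vanishing extends to arbitrary φ. -/
theorem IsSkewInvariant.polar_eq_zero_of_triple (hs : IsSkewInvariant s)
    (hs3 : s ∈ symPow k (V k L U) 3) (b : Module.Basis (Fin 2) k U) {χ₁ χ₂ : L → Fin 2}
    {p q r : L} (hpq : p ≠ q) (hpr : p ≠ r) (hqr : q ≠ r) (h₁ : χ₁ p = χ₁ q) (h₁' : χ₁ p = χ₁ r)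
    (h₂ : χ₂ p = χ₂ q) (h₂' : χ₂ p = χ₂ r) (φ : Module.Dual k (V k L U)) :
    polar s φ (coord b χ₁) (coord b χ₂) = 0 := by
  obtain ⟨v, -, hv⟩ := exists_ι_eq_partialDeriv hs3 (coord b χ₁) (coord b χ₂)
  rw [hv, eq_zero_of_coord_eq_zero b v fun χ => ?_, map_zero]
  rw [← hv]
  by_cases h : χ p = χ q
  · exact hs.polar_eq_zero b hpq h h₁ h₂
  by_cases h' : χ p = χ r
  · exact hs.polar_eq_zero b hpr h' h₁' h₂'
  · exact hs.polar_eq_zero b hqr (by omega) (h₁.symm.trans h₁') (h₂.symm.trans h₂')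

variable [FiniteDimensional k U] (hU : Module.finrank k U = 2) {ω : LinearMap.BilinForm k U} (hω : ω.IsAlt)

/-- The second derivatives of a skew-invariant cubic are multiples of matchings. -/
theorem IsSkewInvariant.exists_polar_eq (hs : IsSkewInvariant s) (hs3 : s ∈ symPow k (V k L U) 3)
    (hs0 : s ≠ 0) {b : Module.Basis (Fin 2) k U} (hb : ω (b 0) (b 1) ≠ 0) (Γ : Fin 4 × Fin 2 ≃ L)
    {P Q : Fin 4 → Fin 2} (hPQ : Function.Injective fun i => (P i, Q i)) :
    ∃ c : k, c ≠ 0 ∧ ∀ φ, polar s φ (coord b (edgeLabel Γ P)) (coord b (edgeLabel Γ Q)) =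
      c * φ (matchingElt hU hω Γ) := by
  obtain ⟨v, -, hv⟩ :=
    exists_ι_eq_partialDeriv hs3 (coord b (edgeLabel Γ P)) (coord b (edgeLabel Γ Q))
  have hsupp : SupportedOn b Γ v := by
    intro χ hχ
    rw [IsTransversal] at hχ
    push Not at hχ
    obtain ⟨i, hi⟩ := hχ
    rw [← hv]
    exact hs.polar_eq_zero b (p := Γ (i, 0)) (q := Γ (i, 1)) (by simp) hi
      (by simp only [edgeLabel_apply]) (by simp only [edgeLabel_apply])
  obtain ⟨c, hc⟩ := hsupp.exists_eq_smul hU hω hb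
  refine ⟨c, ?_, fun φ => by rw [hv, hc, map_smul, smul_eq_mul]⟩
  rintro rfl
  have hL : Fintype.card L = 8 := by rw [← Fintype.card_congr Γ]; simp
  refine hs.polar_ne_zero hL hs3 hs0 b (χ₁ := fun l => (Γ.symm l).2) (χ₂ := edgeLabel Γ P)
    (χ₃ := edgeLabel Γ Q) ?_ (by rw [hv, hc, zero_smul, map_zero])
  intro p q hpq
  simp only [cubeLabel, Prod.mk.injEq, edgeLabel] at hpq
  apply Γ.symm.injective
  exact Prod.ext (hPQ (Prod.ext hpq.2.1 hpq.2.2)) hpq.1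

/-- An endomorphism which annihilates a skew-invariant cubic has all matchings as eigenvectors. -/
theorem IsSkewInvariant.exists_apply_eq_smul (hs : IsSkewInvariant s)
    (hs3 : s ∈ symPow k (V k L U) 3) (hs0 : s ≠ 0) {b : Module.Basis (Fin 2) k U}
    (hb : ω (b 0) (b 1) ≠ 0) {A : Module.End k (V k L U)} (hA : glAction A s = 0)
    (Γ : Fin 4 × Fin 2 ≃ L) :
    ∃ μ : k, A (matchingElt hU hω Γ) = μ • matchingElt hU hω Γ := by
  refine SupportedOn.exists_eq_smul hU hω hb fun χ hχ => ?_
  by_contra hne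
  have hsum := sum_val_eq_of_coord_ne_zero Γ hne
  rw [IsTransversal] at hχ
  push Not at hχ
  obtain ⟨i, hi⟩ := hχ
  by_cases hconst : ∀ j, χ (Γ (j, 0)) = χ (Γ (j, 1))
  -- When every edge is constant, χ itself is used twice, with a second labelling completing it to
  -- separate the edges. The term with χ untouched in both slots vanishes, and the other two are
  -- equal; both are `c` times the coordinate in question.
  · set P : Fin 4 → Fin 2 := fun j => χ (Γ (j, 0)) with hP
    have hχP : χ = edgeLabel Γ P := by
      funext l
      obtain ⟨⟨j, c⟩, rfl⟩ := Γ.surjective l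
      rw [edgeLabel_apply]
      obtain rfl | rfl : c = 0 ∨ c = 1 := by omega
      · rfl
      · exact (hconst j).symm
    have hPsum : (∑ i, (P i).val) = 2 := by
      simp only [← hconst, ← two_mul, ← Finset.mul_sum] at hsum
      simp only [hP]
      omega
    obtain ⟨x, y, hxy⟩ := exists_injective_pair P hPsum
    obtain ⟨c, hc, hpol⟩ := hs.exists_polar_eq hU hω hs3 hs0 hb Γ hxy
    have hrel := polar_glAction hA (coord b (edgeLabel Γ P)) (coord b (edgeLabel Γ P))
      (coord b (edgeLabel Γ fun z => if z = x ∨ z = y then 0 else 1))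
    obtain ⟨j, l, hjl, hPjl⟩ := exists_ne_apply_eq P
    have hPP : ∀ φ, polar s φ (coord b (edgeLabel Γ P)) (coord b (edgeLabel Γ P)) = 0 :=
      hs.polar_eq_zero_of_triple hs3 b (p := Γ (j, 0)) (q := Γ (j, 1)) (r := Γ (l, 0))
        (by simp) (by simp [hjl]) (by simp) (by simp only [edgeLabel_apply])
        (by simp only [edgeLabel_apply, hPjl]) (by simp only [edgeLabel_apply])
        (by simp only [edgeLabel_apply, hPjl])
    rw [polar_swap_left s (coord b (edgeLabel Γ P)) (coord b (edgeLabel Γ P) ∘ₗ A),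
      polar_swap_right s (coord b (edgeLabel Γ P)) (coord b (edgeLabel Γ P)),
      polar_swap_left s (coord b (edgeLabel Γ P)) (_ ∘ₗ A),
      hPP, hpol, add_zero, ← two_mul] at hrel
    rw [hχP] at hne
    exact hne (((mul_eq_zero.1 hrel).resolve_left two_ne_zero |> mul_eq_zero.1).resolve_left hc)
  · push Not at hconst
    obtain ⟨j, hj⟩ := hconst
    -- Parity: the labels sum to 4, and exactly the non-constant edges contribute an odd amount.
    have hl : ∃ l, l ≠ j ∧ χ (Γ (l, 0)) ≠ χ (Γ (l, 1)) := by
      by_contra hcon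
      push Not at hcon
      rw [← Finset.add_sum_erase Finset.univ _ (Finset.mem_univ j),
        Finset.sum_congr rfl fun l hl => by rw [hcon l (Finset.ne_of_mem_erase hl), ← two_mul],
        ← Finset.mul_sum] at hsum
      omega
    obtain ⟨l, hlj, hl⟩ := hl
    have hij : i ≠ j := fun h => hj (h ▸ hi)
    have hil : i ≠ l := fun h => hl (h ▸ hi)
    obtain ⟨c, hc, hpol⟩ := hs.exists_polar_eq hU hω hs3 hs0 hb Γ
      (injective_edge_pair i j l hij hil hlj.symm)
    -- The two ends of `i` and the end of `x` with the same χ-label form a triple not separated by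
    -- either labelling. With `x = l` and `x = j` this removes two of the three terms of the
    -- relation below.
    have hzero : ∀ x, i ≠ x → χ (Γ (x, 0)) ≠ χ (Γ (x, 1)) → ∀ φ,
        polar s φ (coord b χ) (coord b (edgeLabel Γ fun z => if z = i ∨ z = x then 0 else 1)) =
          0 := by
      intro x hix hx φ
      obtain ⟨d, hd⟩ : ∃ d, χ (Γ (i, 0)) = χ (Γ (x, d)) := by
        by_cases h : χ (Γ (i, 0)) = χ (Γ (x, 0))
        · exact ⟨0, h⟩
        · exact ⟨1, by omega⟩
      exact hs.polar_eq_zero_of_triple hs3 b (p := Γ (i, 0)) (q := Γ (i, 1)) (r := Γ (x, d))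
        (by simp) (by simp [hix]) (by simp [hix]) hi hd (by simp only [edgeLabel_apply])
        (by simp [edgeLabel_apply]) φ
    have hrel := polar_glAction hA (coord b χ)
      (coord b (edgeLabel Γ fun z => if z = i ∨ z = j then 0 else 1))
      (coord b (edgeLabel Γ fun z => if z = i ∨ z = l then 0 else 1))
    rw [polar_swap_left s (coord b χ) (_ ∘ₗ A), hzero l hil hl,
      polar_swap_right s (coord b χ), polar_swap_left s (coord b χ) (_ ∘ₗ A), hzero j hij hj,
      hpol, add_zero, add_zero] at hrel
    exact hne ((mul_eq_zero.1 hrel).resolve_left hc)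

end SkewCubics

/-! ### Plücker relations between matchings. -/

section Plucker

variable {k L U : Type*} [Field k] [AddCommGroup U] [Module k U]

theorem plucker_basis {ω : LinearMap.BilinForm k U} (hω : ω.IsAlt) (b : Module.Basis (Fin 2) k U)
    (x y z w : Fin 2) :
    ω (b x) (b y) * ω (b z) (b w) - ω (b x) (b z) * ω (b y) (b w) +
      ω (b x) (b w) * ω (b y) (b z) = 0 := by
  have h10 : ω (b 1) (b 0) = - ω (b 0) (b 1) := (hω.neg_eq _ _).symm
  have h00 := hω.self_eq_zero (b 0)
  have h11 := hω.self_eq_zero (b 1)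
  fin_cases x <;> fin_cases y <;> fin_cases z <;> fin_cases w <;> simp [h10, h00, h11]

theorem prod_eq_mul_mul_prod_erase {m : ℕ} {i j : Fin m} (hij : i ≠ j) (f : Fin m → k) :
    ∏ l, f l = f i * f j * ∏ l ∈ (Finset.univ.erase i).erase j, f l := by
  rw [mul_assoc, Finset.mul_prod_erase _ _ (by simp [hij.symm]),
    Finset.mul_prod_erase _ _ (Finset.mem_univ i)]

variable [Finite L] [FiniteDimensional k U] (hU : Module.finrank k U = 2)
  {ω : LinearMap.BilinForm k U} (hω : ω.IsAlt)

/-- The Plücker relation between the three matchings which differ in two edges. -/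
theorem matchingElt_plucker (b : Module.Basis (Fin 2) k U) {m : ℕ} (Γ : Fin m × Fin 2 ≃ L)
    {i j : Fin m} (hij : i ≠ j) (c : Fin 2) {d d' : Fin 2} (hd : d ≠ d') :
    matchingElt hU hω Γ = matchingElt hU hω ((Equiv.swap (i, c) (j, d)).trans Γ) +
      matchingElt hU hω ((Equiv.swap (i, c) (j, d')).trans Γ) := by
  refine coord_ext b fun χ => ?_
  rw [map_add, coord_matchingElt, coord_matchingElt, coord_matchingElt]
  have hrest : ∀ d : Fin 2, ∏ l ∈ (Finset.univ.erase i).erase j,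
      ω (b (χ (((Equiv.swap (i, c) (j, d)).trans Γ) (l, 0))))
        (b (χ (((Equiv.swap (i, c) (j, d)).trans Γ) (l, 1)))) =
      ∏ l ∈ (Finset.univ.erase i).erase j, ω (b (χ (Γ (l, 0)))) (b (χ (Γ (l, 1)))) := by
    intro d
    refine Finset.prod_congr rfl fun l hl => ?_
    rw [Finset.mem_erase, Finset.mem_erase] at hl
    rw [Equiv.trans_apply, Equiv.trans_apply,
      Equiv.swap_apply_of_ne_of_ne (by simp [hl.2.1]) (by simp [hl.1]),
      Equiv.swap_apply_of_ne_of_ne (by simp [hl.2.1]) (by simp [hl.1])]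
  rw [prod_eq_mul_mul_prod_erase hij, prod_eq_mul_mul_prod_erase hij,
    prod_eq_mul_mul_prod_erase hij, hrest, hrest, ← add_mul]
  congr 1
  have hpl := plucker_basis hω b (χ (Γ (i, 0))) (χ (Γ (i, 1))) (χ (Γ (j, 0))) (χ (Γ (j, 1)))
  have hneg : ∀ c d, ω (b (χ (Γ (j, d)))) (b (χ (Γ (i, c)))) =
      - ω (b (χ (Γ (i, c)))) (b (χ (Γ (j, d)))) := fun c d => (hω.neg_eq _ _).symm
  obtain rfl | rfl : c = 0 ∨ c = 1 := by omega
  all_goals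
    obtain ⟨rfl, rfl⟩ | ⟨rfl, rfl⟩ : (d = 0 ∧ d' = 1) ∨ (d = 1 ∧ d' = 0) := by omega
  all_goals
    simp only [Equiv.trans_apply, Equiv.swap_apply_def, Prod.mk.injEq, hij, hij.symm, zero_ne_one,
      one_ne_zero, and_false, and_true, and_self, if_true, if_false, hneg]
    linear_combination hpl

end Plucker

/-! ### All matchings share one eigenvalue, and the annihilator is zero. -/

section Annihilator

variable {k L U : Type*} [Field k] [CharZero k] [AddCommGroup U] [Module k U]
  [Fintype L] [DecidableEq L]
  [FiniteDimensional k U] (hU : Module.finrank k U = 2)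
  {ω : LinearMap.BilinForm k U} (hω : ω.IsAlt)

theorem matchingElt_swap_edge (b : Module.Basis (Fin 2) k U) {m : ℕ} (Γ : Fin m × Fin 2 ≃ L)
    (i : Fin m) : matchingElt hU hω ((Equiv.swap (i, 0) (i, 1)).trans Γ) =
      - matchingElt hU hω Γ := by
  refine coord_ext b fun χ => ?_
  rw [map_neg, ← (supportedOn_matchingElt hU hω b Γ).coord_comp_swap χ i, coord_matchingElt,
    coord_matchingElt]
  simp only [Equiv.trans_apply, Function.comp_apply, Γ.injective.map_swap]

theorem apply_matchingElt_swap {b : Module.Basis (Fin 2) k U} (hb : ω (b 0) (b 1) ≠ 0) {m : ℕ}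
    {A : Module.End k (V k L U)}
    (hA : ∀ Γ : Fin m × Fin 2 ≃ L, ∃ μ : k, A (matchingElt hU hω Γ) = μ • matchingElt hU hω Γ)
    {Γ : Fin m × Fin 2 ≃ L} {μ : k} (hμ : A (matchingElt hU hω Γ) = μ • matchingElt hU hω Γ)
    {p q : Fin m × Fin 2} (hpq : p ≠ q) :
    A (matchingElt hU hω ((Equiv.swap p q).trans Γ)) =
      μ • matchingElt hU hω ((Equiv.swap p q).trans Γ) := by
  obtain ⟨i, c⟩ := p
  obtain ⟨j, d⟩ := q
  by_cases hij : i = j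
  · subst hij
    have key : matchingElt hU hω ((Equiv.swap (i, c) (i, d)).trans Γ) =
        - matchingElt hU hω Γ := by
      have hcd : c ≠ d := fun h => hpq (by rw [h])
      obtain ⟨rfl, rfl⟩ | ⟨rfl, rfl⟩ : (c = 0 ∧ d = 1) ∨ (c = 1 ∧ d = 0) := by omega
      · exact matchingElt_swap_edge hU hω b Γ i
      · rw [Equiv.swap_comm]
        exact matchingElt_swap_edge hU hω b Γ i
    rw [key, map_neg, hμ, smul_neg]
  obtain ⟨d', hd⟩ : ∃ d', d' ≠ d := exists_ne d
  have hpl := matchingElt_plucker hU hω b Γ hij c hd.symm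
  obtain ⟨μ₁, h₁⟩ := hA ((Equiv.swap (i, c) (j, d)).trans Γ)
  obtain ⟨μ₂, h₂⟩ := hA ((Equiv.swap (i, c) (j, d')).trans Γ)
  -- Apply A to the Plücker relation and eliminate its last matching.
  have hrel : (μ - μ₂) • matchingElt hU hω Γ =
      (μ₁ - μ₂) • matchingElt hU hω ((Equiv.swap (i, c) (j, d)).trans Γ) := by
    have h := congrArg A hpl
    rw [map_add, hμ, h₁, h₂, ← sub_eq_iff_eq_add'.2 hpl] at h
    rw [sub_smul, sub_smul, h, smul_sub]
    abel
  -- Constant on edges `i` and `j` with different values: not transversal to Γ, but transversal once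
  -- an end of `i` is exchanged with an end of `j`. This coordinate shows that the two matchings are
  -- not proportional.
  set χ : L → Fin 2 := fun l =>
    if (Γ.symm l).1 = i then 0 else if (Γ.symm l).1 = j then 1 else (Γ.symm l).2 with hχ
  have hχΓ : ∀ x e, χ (Γ (x, e)) = if x = i then 0 else if x = j then 1 else e := fun x e => by
    simp [hχ]
  have hX : coord b χ (matchingElt hU hω Γ) = 0 :=
    supportedOn_matchingElt hU hω b Γ χ fun h => h i (by simp [hχΓ])
  have hX₁ : coord b χ (matchingElt hU hω ((Equiv.swap (i, c) (j, d)).trans Γ)) ≠ 0 := by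
    refine coord_matchingElt_ne_zero hU hω hb fun x => ?_
    have hji : j ≠ i := Ne.symm hij
    simp only [Equiv.trans_apply, Equiv.swap_apply_def, Prod.mk.injEq]
    by_cases hxi : x = i
    · subst hxi
      obtain rfl | rfl : c = 0 ∨ c = 1 := by omega
      all_goals simp [hχΓ, hij, hji]
    by_cases hxj : x = j
    · subst hxj
      obtain rfl | rfl : d = 0 ∨ d = 1 := by omega
      all_goals simp [hχΓ, hji]
    · simp [hχΓ, hxi, hxj]
  have h12 : μ₁ = μ₂ := by
    have h := congrArg (coord b χ) hrel
    rw [map_smul, map_smul, hX, smul_zero, smul_eq_mul, eq_comm, mul_eq_zero] at h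
    exact sub_eq_zero.1 (h.resolve_right hX₁)
  have hμ2 : μ = μ₂ := by
    rw [h12, sub_self, zero_smul, smul_eq_zero] at hrel
    refine sub_eq_zero.1 (hrel.resolve_right fun h0 => ?_)
    refine coord_matchingElt_ne_zero hU hω hb (Γ := Γ) (χ := fun l => (Γ.symm l).2)
      (fun x => by simp) ?_
    rw [h0, map_zero]
  rw [h₁, h12, hμ2]

theorem IsSkewInvariant.eq_zero_of_glAction_eq_zero (hU : Module.finrank k U = 2) (hω : ω.IsAlt)
    {s : SymmetricAlgebra k (V k L U)}
    (hs : IsSkewInvariant s) (hL : Fintype.card L = 8) (hs3 : s ∈ symPow k (V k L U) 3)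
    (hs0 : s ≠ 0) {b : Module.Basis (Fin 2) k U} (hb : ω (b 0) (b 1) ≠ 0)
    {A : Module.End k (V k L U)} (hA : glAction A s = 0) : A = 0 := by
  have heig := hs.exists_apply_eq_smul hU hω hs3 hs0 hb hA
  let Γ₀ : Fin 4 × Fin 2 ≃ L := Fintype.equivOfCardEq (by simp [hL])
  obtain ⟨μ, hμ⟩ := heig Γ₀
  have hperm : ∀ σ : Equiv.Perm (Fin 4 × Fin 2),
      A (matchingElt hU hω (σ.trans Γ₀)) = μ • matchingElt hU hω (σ.trans Γ₀) := by
    intro σ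
    induction σ using Equiv.Perm.swap_induction_on' with
    | one => exact hμ
    | mul_swap σ x y hxy ih => exact apply_matchingElt_swap hU hω hb heig ih hxy
  have hAμ : A = μ • 1 := by
    refine LinearMap.ext fun t => ?_
    have := mem_of_matchingElt_mem hU hω hb Γ₀ (LinearMap.ker (A - μ • 1)) (fun Γ => ?_) t
    · rw [LinearMap.mem_ker, LinearMap.sub_apply, sub_eq_zero] at this
      exact this
    · have h := hperm (Γ.trans Γ₀.symm)
      rw [Equiv.trans_assoc, Equiv.symm_trans_self, Equiv.trans_refl] at h
      rw [LinearMap.mem_ker, LinearMap.sub_apply, sub_eq_zero, h]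
      rfl
  rw [hAμ, glAction_smul, Derivation.smul_apply, glAction_one 3 s hs3, smul_smul, smul_eq_zero,
    mul_eq_zero] at hA
  have hμ0 : μ = 0 := (hA.resolve_right hs0).resolve_right (by norm_num)
  rw [hAμ, hμ0, zero_smul]

end Annihilator

/-! ### The skew-average of the cube of a matching. -/

section SkewAverage

variable {k L U : Type*} [Field k] [AddCommGroup U] [Module k U]

theorem permSym_mem_symPow (σ : Equiv.Perm L) (n : ℕ) {f : SymmetricAlgebra k (V k L U)}
    (hf : f ∈ symPow k (V k L U) n) : permSym k U σ f ∈ symPow k (V k L U) n :=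
  lift_mem_symPow (permV k U σ) n f hf

theorem permSym_permSym [Finite L] (b : Module.Basis (Fin 2) k U) (σ τ : Equiv.Perm L)
    (f : SymmetricAlgebra k (V k L U)) :
    permSym k U σ (permSym k U τ f) = permSym k U (σ * τ) f := by
  have h : (permSym k U σ).comp (permSym k U τ) = permSym k U (σ * τ) := by
    apply SymmetricAlgebra.algHom_ext
    refine LinearMap.ext fun v => ?_
    simp [permSym, permV_permV b]
  exact congrArg (fun F => F f) h

variable [Fintype L] [DecidableEq L]

theorem skewAverage_mem_symPow (n : ℕ) {f : SymmetricAlgebra k (V k L U)}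
    (hf : f ∈ symPow k (V k L U) n) : skewAverage f ∈ symPow k (V k L U) n :=
  Submodule.smul_mem _ _ (Submodule.sum_mem _ fun σ _ =>
    zsmul_mem (permSym_mem_symPow σ n hf) _)

theorem isSkewInvariant_skewAverage (b : Module.Basis (Fin 2) k U)
    (f : SymmetricAlgebra k (V k L U)) : IsSkewInvariant (skewAverage f) := by
  intro τ
  rw [skewAverage, map_smul, map_sum, smul_comm]
  congr 1
  rw [Finset.smul_sum]
  rw [← Equiv.sum_comp (Equiv.mulLeft τ)
    fun σ => (Equiv.Perm.sign τ : ℤ) • (Equiv.Perm.sign σ : ℤ) • permSym k U σ f]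
  refine Finset.sum_congr rfl fun σ _ => ?_
  rw [map_zsmul, permSym_permSym b, Equiv.coe_mulLeft, smul_smul, Equiv.Perm.sign_mul,
    Units.val_mul, ← mul_assoc, ← Units.val_mul, Int.units_mul_self, Units.val_one, one_mul]

theorem polar_skewAverage (b : Module.Basis (Fin 2) k U) (f : SymmetricAlgebra k (V k L U))
    (χ₁ χ₂ χ₃ : L → Fin 2) :
    polar (skewAverage f) (coord b χ₁) (coord b χ₂) (coord b χ₃) =
      (Fintype.card (Equiv.Perm L) : k)⁻¹ * ∑ σ : Equiv.Perm L,
        ((Equiv.Perm.sign σ : ℤ) : k) *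
          polar f (coord b (χ₁ ∘ σ)) (coord b (χ₂ ∘ σ)) (coord b (χ₃ ∘ σ)) := by
  rw [skewAverage, ← polarₗ_apply, map_smul, map_sum, smul_eq_mul]
  congr 1
  refine Finset.sum_congr rfl fun σ _ => ?_
  rw [map_zsmul, polarₗ_apply, permSym, polar_lift, coord_comp_permV, coord_comp_permV,
    coord_comp_permV, zsmul_eq_mul]

/-- The nontrivial character of `ℤ/2`. -/
def parity (k : Type*) [Field k] (x : Fin 2) : k := if x = 0 then 1 else -1

theorem parity_add (x y : Fin 2) : parity k (x + y) = parity k x * parity k y := by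
  fin_cases x <;> fin_cases y <;> simp [parity]

theorem parity_mul_self (x : Fin 2) : parity k x * parity k x = 1 := by
  fin_cases x <;> simp [parity]

theorem parity_ne_zero (x : Fin 2) : parity k x ≠ 0 := by
  fin_cases x <;> simp [parity]

theorem sign_addRight (x : Fin 2) :
    ((Equiv.Perm.sign (Equiv.addRight x) : ℤ) : k) = parity k x := by
  have h1 : Equiv.Perm.sign (Equiv.addRight (1 : Fin 2)) = -1 := by decide
  obtain rfl | rfl : x = 0 ∨ x = 1 := by omega
  · simp [parity]
  · simp [h1, parity]

theorem form_basis_add_one {ω : LinearMap.BilinForm k U} (hω : ω.IsAlt)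
    (b : Module.Basis (Fin 2) k U) (x : Fin 2) :
    ω (b x) (b (1 + x)) = ω (b 0) (b 1) * parity k x := by
  have h10 : ω (b 1) (b 0) = - ω (b 0) (b 1) := (hω.neg_eq _ _).symm
  fin_cases x <;> simp [parity, h10]

/-- A permutation of the vertices which is transversal to a matching with respect to three
labellings that distinguish all vertices up to a simultaneous flip permutes the edges. -/
theorem exists_edge_perm {m : ℕ} (P Q : Fin m → Fin 2)
    (hPQ : Function.Injective fun i => (P i, Q i)) (σ : Equiv.Perm (Fin m × Fin 2))
    (h₁ : ∀ i, (σ (i, 0)).2 ≠ (σ (i, 1)).2)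
    (h₂ : ∀ i, (σ (i, 0)).2 + P (σ (i, 0)).1 ≠ (σ (i, 1)).2 + P (σ (i, 1)).1)
    (h₃ : ∀ i, (σ (i, 0)).2 + Q (σ (i, 0)).1 ≠ (σ (i, 1)).2 + Q (σ (i, 1)).1) :
    ∃ (τ : Equiv.Perm (Fin m)) (f : Fin m → Fin 2), ∀ i c, σ (i, c) = (τ i, c + f i) := by
  have hfst : ∀ i, (σ (i, 1)).1 = (σ (i, 0)).1 := by
    intro i
    apply hPQ
    have h1 := h₁ i
    have h2 := h₂ i
    have h3 := h₃ i
    generalize σ (i, 0) = p at *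
    generalize σ (i, 1) = q at *
    refine Prod.ext ?_ ?_ <;> simp only <;> omega
  have hσ : ∀ i c, σ (i, c) = ((σ (i, 0)).1, c + (σ (i, 0)).2) := by
    intro i c
    obtain rfl | rfl : c = 0 ∨ c = 1 := by omega
    · rw [zero_add]
    · refine Prod.ext (hfst i) ?_
      have h1 := h₁ i
      simp only
      omega
  have hinj : Function.Injective fun i => (σ (i, 0)).1 := by
    intro i j hij
    simp only at hij
    have h : σ (i, (σ (j, 0)).2 - (σ (i, 0)).2) = σ (j, 0) := by
      rw [hσ i, hij, sub_add_cancel]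
    exact congrArg Prod.fst (σ.injective h)
  exact ⟨Equiv.ofBijective _ (Finite.injective_iff_bijective.1 hinj), fun i => (σ (i, 0)).2, hσ⟩

/-- τ acts on two copies of the set of edges, so its sign is squared away and only the edge
reversals count. -/
theorem sign_of_edge_perm {m : ℕ} (σ : Equiv.Perm (Fin m × Fin 2)) (τ : Equiv.Perm (Fin m))
    (f : Fin m → Fin 2) (h : ∀ i c, σ (i, c) = (τ i, c + f i)) :
    ((Equiv.Perm.sign σ : ℤ) : k) = ∏ i, parity k (f i) := by
  have hσ : σ = Equiv.prodCongrLeft (fun _ : Fin 2 => τ) *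
      Equiv.prodCongrRight (fun i => Equiv.addRight (f i)) := by
    ext ⟨i, c⟩ <;> simp [h]
  rw [hσ, Equiv.Perm.sign_mul, Equiv.Perm.sign_prodCongrLeft, Equiv.Perm.sign_prodCongrRight,
    Fin.prod_univ_two, Int.units_mul_self, one_mul, Units.coe_prod, Int.cast_prod]
  exact Finset.prod_congr rfl fun i _ => sign_addRight (f i)

variable [FiniteDimensional k U] (hU : Module.finrank k U = 2)
  {ω : LinearMap.BilinForm k U} (hω : ω.IsAlt)

theorem coord_comp_matchingElt_of_edge_perm (b : Module.Basis (Fin 2) k U) {m : ℕ}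
    (Γ : Fin m × Fin 2 ≃ L) (σ : Equiv.Perm L) (τ : Equiv.Perm (Fin m)) (f : Fin m → Fin 2)
    (h : ∀ i c, Γ.symm (σ (Γ (i, c))) = (τ i, c + f i)) (P : Fin m → Fin 2) :
    coord b ((fun l => (Γ.symm l).2 + P (Γ.symm l).1) ∘ σ) (matchingElt hU hω Γ) =
      ω (b 0) (b 1) ^ m * (∏ i, parity k (f i)) * ∏ i, parity k (P i) := by
  rw [coord_matchingElt, ← Equiv.prod_comp τ fun i => parity k (P i), mul_assoc,
    ← Finset.prod_mul_distrib, ← Fin.prod_const, ← Finset.prod_mul_distrib]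
  refine Finset.prod_congr rfl fun i _ => ?_
  simp only [Function.comp_apply, h]
  rw [zero_add, add_assoc, form_basis_add_one hω, parity_add]

/-- The skew-average of the cube of a matching does not vanish. -/
theorem skewAverage_pow_three_ne_zero [CharZero k] {b : Module.Basis (Fin 2) k U}
    (hb : ω (b 0) (b 1) ≠ 0) (Γ : Fin 4 × Fin 2 ≃ L) :
    skewAverage (SymmetricAlgebra.ι k (V k L U) (matchingElt hU hω Γ) ^ 3) ≠ 0 := by
  obtain ⟨P, Q, hPQ⟩ : ∃ P Q : Fin 4 → Fin 2, Function.Injective fun i => (P i, Q i) :=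
    ⟨![0, 0, 1, 1], ![0, 1, 0, 1], by decide⟩
  -- All these labellings are transversals of Γ, so the identity contributes a nonzero term.
  set χ : (Fin 4 → Fin 2) → L → Fin 2 := fun P l => (Γ.symm l).2 + P (Γ.symm l).1 with hχ
  set X := matchingElt hU hω Γ with hX
  set T : Equiv.Perm L → k := fun σ => ((Equiv.Perm.sign σ : ℤ) : k) *
    (coord b (χ 0 ∘ σ) X * coord b (χ P ∘ σ) X * coord b (χ Q ∘ σ) X) with hT
  have hmul : ∀ f : Fin 4 → Fin 2, (∏ i, parity k (f i)) * ∏ i, parity k (f i) = 1 := fun f => by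
    rw [← Finset.prod_mul_distrib, Finset.prod_eq_one fun i _ => parity_mul_self (f i)]
  set K : k := (ω (b 0) (b 1) ^ 4) ^ 3 * ((∏ i, parity k (P i)) * ∏ i, parity k (Q i)) with hK
  have hK0 : K ≠ 0 := mul_ne_zero (pow_ne_zero _ (pow_ne_zero _ hb))
    (mul_ne_zero (Finset.prod_ne_zero_iff.2 fun i _ => parity_ne_zero _)
      (Finset.prod_ne_zero_iff.2 fun i _ => parity_ne_zero _))
  have hval : ∀ (σ : Equiv.Perm L) (τ : Equiv.Perm (Fin 4)) (f : Fin 4 → Fin 2),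
      (∀ i c, Γ.symm (σ (Γ (i, c))) = (τ i, c + f i)) → T σ = K := by
    intro σ τ f h
    have hsign : ((Equiv.Perm.sign σ : ℤ) : k) = ∏ i, parity k (f i) := by
      rw [← sign_of_edge_perm ((Γ.trans σ).trans Γ.symm) τ f h,
        Equiv.Perm.sign_trans_trans_symm]
    have h0 : ∏ i : Fin 4, parity k ((0 : Fin 4 → Fin 2) i) = 1 := by simp [parity]
    simp only [hT, hχ, hX]
    rw [hsign, coord_comp_matchingElt_of_edge_perm hU hω b Γ σ τ f h,
      coord_comp_matchingElt_of_edge_perm hU hω b Γ σ τ f h,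
      coord_comp_matchingElt_of_edge_perm hU hω b Γ σ τ f h, h0, hK]
    -- With e = ∏ parity (f i), the sign of σ and the three coordinates contribute e⁴ in all, and e⁴
    -- − 1 = (1 + e²)(e² − 1).
    linear_combination ((ω (b 0) (b 1) ^ 4) ^ 3 * ((∏ i, parity k (P i)) *
      ∏ i, parity k (Q i))) * (1 + (∏ i, parity k (f i)) * ∏ i, parity k (f i)) * hmul f
  have hone : T 1 = K := hval 1 1 0 fun i c => by simp
  -- A nonzero term makes all three relabelled coordinates transversal, which forces σ to permute
  -- the edges of Γ.
  have hdich : ∀ σ, T σ ≠ 0 → T σ = K := by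
    intro σ hσ
    have htr : ∀ R, coord b (χ R ∘ σ) X ≠ 0 → ∀ i,
        χ R (σ (Γ (i, 0))) ≠ χ R (σ (Γ (i, 1))) := by
      intro R hR
      by_contra hcon
      exact hR (supportedOn_matchingElt hU hω b Γ _ hcon)
    have h := right_ne_zero_of_mul hσ
    obtain ⟨τ, f, hτ⟩ := exists_edge_perm P Q hPQ ((Γ.trans σ).trans Γ.symm)
      (fun i => by simpa [hχ] using htr 0 (left_ne_zero_of_mul (left_ne_zero_of_mul h)) i)
      (htr P (right_ne_zero_of_mul (left_ne_zero_of_mul h)))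
      (htr Q (right_ne_zero_of_mul h))
    exact hval σ τ f hτ
  classical
  intro hzero
  have hpol := polar_skewAverage b (SymmetricAlgebra.ι k (V k L U) X ^ 3) (χ 0) (χ P) (χ Q)
  have hsum : ∑ σ : Equiv.Perm L, ((Equiv.Perm.sign σ : ℤ) : k) *
      polar (SymmetricAlgebra.ι k (V k L U) X ^ 3) (coord b (χ 0 ∘ σ)) (coord b (χ P ∘ σ))
        (coord b (χ Q ∘ σ)) = 6 * ((Finset.univ.filter fun σ => T σ ≠ 0).card * K) := by
    rw [← nsmul_eq_mul, ← Finset.sum_const,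
      ← Finset.sum_congr rfl fun σ hσ => hdich σ (Finset.mem_filter.1 hσ).2,
      Finset.sum_filter_ne_zero, Finset.mul_sum]
    refine Finset.sum_congr rfl fun σ _ => ?_
    rw [polar_ι_pow_three, hT]
    ring
  rw [hzero, hsum, ← polarₗ_apply, map_zero, eq_comm] at hpol
  have hcard : ((Finset.univ.filter fun σ => T σ ≠ 0).card : k) ≠ 0 := by
    refine Nat.cast_ne_zero.2 (Finset.card_ne_zero.2 ⟨1, ?_⟩)
    simp [hone, hK0]
  exact mul_ne_zero (inv_ne_zero (Nat.cast_ne_zero.2 Fintype.card_ne_zero))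
    (mul_ne_zero (by norm_num) (mul_ne_zero hcard hK0)) hpol

end SkewAverage

end EightPoints

end

theorem mainTheorem7 {k L U : Type*} [Field k] [CharZero k]
    [Fintype L] [DecidableEq L] (hL : Fintype.card L = 8)
    [AddCommGroup U] [Module k U] [FiniteDimensional k U] (hU : Module.finrank k U = 2)
    (ω : LinearMap.BilinForm k U) (hω : ω.IsAlt) (hω' : ω.Nondegenerate) :
    (∀ s : SymmetricAlgebra k (EightPoints.V k L U),
      s ∈ EightPoints.symPow k (EightPoints.V k L U) 3 → EightPoints.IsSkewInvariant s → s ≠ 0 →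
        (∀ (n : ℕ) (x : Module.Basis (Fin n) k (EightPoints.V k L U)),
            EightPoints.NoLinearSyzygies x s) ∧
          EightPoints.annihilator s = ⊥) ∧
    (∀ (Γ : Fin 4 × Fin 2 ≃ L) (s : SymmetricAlgebra k (EightPoints.V k L U)),
      s = EightPoints.skewAverage
          (SymmetricAlgebra.ι k (EightPoints.V k L U) (EightPoints.matchingElt hU hω Γ) ^ 3) →
        (∀ (n : ℕ) (x : Module.Basis (Fin n) k (EightPoints.V k L U)),
            EightPoints.NoLinearSyzygies x s) ∧
          EightPoints.annihilator s = ⊥) := by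
  let b : Module.Basis (Fin 2) k U := Module.finBasisOfFinrankEq k U hU
  have hb : ω (b 0) (b 1) ≠ 0 := by
    intro h
    refine b.ne_zero 0 (hω'.1 (b 0) fun u => ?_)
    rw [← b.sum_repr u, Fin.sum_univ_two, map_add, map_smul, map_smul, h, hω.self_eq_zero,
      smul_zero, smul_zero, add_zero]
  have main : ∀ s : SymmetricAlgebra k (EightPoints.V k L U),
      s ∈ EightPoints.symPow k (EightPoints.V k L U) 3 → EightPoints.IsSkewInvariant s → s ≠ 0 →
        (∀ (n : ℕ) (x : Module.Basis (Fin n) k (EightPoints.V k L U)),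
            EightPoints.NoLinearSyzygies x s) ∧
          EightPoints.annihilator s = ⊥ := by
    intro s hs3 hs hs0
    have hbot : EightPoints.annihilator s = ⊥ := EightPoints.annihilator_eq_bot fun A hA =>
      hs.eq_zero_of_glAction_eq_zero hU hω hL hs3 hs0 hb hA
    exact ⟨fun n x => EightPoints.noLinearSyzygies_of_annihilator_eq_bot hbot x, hbot⟩
  refine ⟨main, ?_⟩
  rintro Γ s rfl
  exact main _
    (EightPoints.skewAverage_mem_symPow 3 (Submodule.pow_mem_pow _ (LinearMap.mem_range_self _ _) 3))
    (EightPoints.isSkewInvariant_skewAverage b _)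
    (EightPoints.skewAverage_pow_three_ne_zero hU hω hb Γ)
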